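/- **Theorem (finite extinction time).** Let $N\ge 1$ be an integer, $s\in(0,1)$, $p\in(1,2)$, and set $p_c=\frac{2N}{N+2s}$ and $\lambda_2=N(p-2)+2ps$. There is a constant $\gamma_*>0$ depending only on $N,p,s$ such that the following holds. Let $0<C_1\le C_2$, $T\in(0,\infty]$, and let $K:\mathbb R^N\times\mathbb R^N\times(0,T)\to\mathbb R$ be measurable with $K(x,y,t)=K(y,x,t)$ and $C_1\le K(x,y,t)\,|x-y|^{N+ps}\le C_2$ almost everywhere. Let $\Omega\subset\mathbb R^N$ be a bounded open set, and write $W^{s,p}_0(\Omega)$ for the set of $v\in L^p(\mathbb R^N)$ with $\iint_{\mathbb R^N\times\mathbb R^N}\frac{|v(x)-v(y)|^p}{|x-y|^{N+ps}}\,dx\,dy<\infty$ and $v=0$ a.e. in $\Omega^c=\mathbb R^N\setminus\Omega$. Let $u_0\in W^{s,p}_0(\Omega)\cap L^\infty(\mathbb R^N)$ with $u_0\ge 0$ a.e. in $\Omega$, and let $u\ge 0$ be a weak solution, bounded on $\mathbb R^N\times(0,T)$, of $$\begin{cases} u_t+\mathcal L_K u=0 & \text{in }\Omega\times(0,T),\\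 u=0 & \text{in }\Omega^c\times(0,T),\\ u(\cdot,0)=u_0 & \text{in }\mathbb R^N,\end{cases}$$ where $\mathcal L_Ku(x,t)=2\lim_{\varepsilon\to0^+}\int_{|x-y|\ge\varepsilon}|u(x,t)-u(y,t)|^{p-2}(u(x,t)-u(y,t))K(x,y,t)\,dy$. For $T<\infty$ this means that $u\in C([0,T];L^2(\Omega))\cap L^p(0,T;W^{s,p}_0(\Omega))$ (with $u(\cdot,t)$ extended by $0$ outside $\Omega$ for every $t$), that $u(\cdot,0)=u_0$ a.e., and that for all $\varphi\in W^{1,2}(0,T;L^2(\Omega))\cap L^p(0,T;W^{s,p}_0(\Omega))$ $$0=\int_\Omega u\varphi\,dx\Big|_0^T-\int_0^T\!\!\int_\Omega u\,\varphi_\tau\,dx\,d\tau+\int_0^T\!\!\iint_{\mathbb R^N\times\mathbb R^N}|u(x,\tau)-u(y,\tau)|^{p-2}(u(x,\tau)-u(y,\tau))(\varphi(x,\tau)-\varphi(y,\tau))K(x,y,\tau)\,dx\,dy\,d\tau,$$ where $\varphi$ is taken as its representative in $C([0,T];L^2(\Omega))$; for $T=\infty$ it means that $u$ is a weak solution on $(0,T')$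 for every $T'\in(0,\infty)$. Define $$T_*=\frac{\gamma_*}{C_1}\|u_0\|_{L^q(\Omega)}^{2-p},\quad q=\frac{N(2-p)}{ps},\qquad\text{if } 1<p<p_c,$$ $$T_*=\frac{\gamma_*}{C_1}\|u_0\|_{L^2(\Omega)}^{2-p}\,|\Omega|^{\frac{\lambda_2}{2N}}\qquad\text{if } p_c\le p<2.$$ Then $T_*\in[0,\infty)$, with $T_*>0$ unless $u_0=0$ a.e., and $u(\cdot,t)=0$ a.e. in $\mathbb R^N$ for every $t\ge T_*$ in the time domain of $u$ (that is, every real $t$ with $T_*\le t\le T$). -/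

import Mathlib

open MeasureTheory Set Filter Topology
open scoped ENNReal ContDiff

noncomputable section

namespace FracPLap

/-- The space `ℝ^N` with its Euclidean norm and Lebesgue measure. -/
abbrev Space (N : ℕ) : Type := EuclideanSpace ℝ (Fin N)

/-- The open time interval `(0, T)`, where `T ∈ (0, ∞]`. -/
def timeInterval (T : EReal) : Set ℝ := {t | 0 < t ∧ (t : EReal) < T}

/-- The critical exponent `p_c = 2N / (N + 2s)`. -/
def pCrit (N : ℕ) (s : ℝ) : ℝ := 2 * N / (N + 2 * s)

/-- `λ_r = N (p - 2) + r p s`. -/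
def lam (N : ℕ) (s p r : ℝ) : ℝ := N * (p - 2) + r * p * s

/-- `∬_{ℝ^N × ℝ^N} |v(x) - v(y)|^p / |x - y|^{N + ps} dx dy`, the `p`-th power of the Gagliardo
seminorm, as an extended nonnegative number. -/
def gagliardo (N : ℕ) (s p : ℝ) (v : Space N → ℝ) : ℝ≥0∞ :=
  ∫⁻ z : Space N × Space N,
    ENNReal.ofReal (|v z.1 - v z.2| ^ p / ‖z.1 - z.2‖ ^ ((N : ℝ) + p * s))

/-- `v ∈ W^{s,p}_0(Ω)`: `v ∈ L^p(ℝ^N)` with finite Gagliardo seminorm, and `v = 0` a.e. in the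
complement of `Ω`. -/
structure MemWsp0 {N : ℕ} (s p : ℝ) (Ω : Set (Space N)) (v : Space N → ℝ) : Prop where
  memLp : MemLp v (ENNReal.ofReal p) volume
  gagliardo_lt_top : gagliardo N s p v < ⊤
  eq_zero : ∀ᵐ x ∂(volume.restrict Ωᶜ), v x = 0

/-- `v ∈ L^p(0, T; W^{s,p}_0(Ω))` for a finite horizon `T`. -/
structure MemLpWsp0 {N : ℕ} (s p : ℝ) (Ω : Set (Space N)) (T : ℝ) (v : ℝ → Space N → ℝ) :
    Prop where
  aestronglyMeasurable : AEStronglyMeasurable (fun z : ℝ × Space N => v z.1 z.2)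
    ((volume.restrict (Ioo 0 T)).prod volume)
  mem : ∀ᵐ t ∂(volume.restrict (Ioo 0 T)), MemWsp0 s p Ω (v t)
  norm_lt_top : ∫⁻ t in Ioo 0 T,
    ((∫⁻ x, ENNReal.ofReal (|v t x| ^ p)) + gagliardo N s p (v t)) < ⊤

/-- `v ∈ C([0, T]; L²(Ω))`. -/
structure MemCL2 {N : ℕ} (Ω : Set (Space N)) (T : ℝ) (v : ℝ → Space N → ℝ) : Prop where
  memLp : ∀ t ∈ Icc 0 T, MemLp (v t) 2 (volume.restrict Ω)
  continuous : ∀ t₀ ∈ Icc 0 T,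
    Tendsto (fun t => eLpNorm (fun x => v t x - v t₀ x) 2 (volume.restrict Ω))
      (𝓝[Icc 0 T] t₀) (𝓝 0)

/-- `φ ∈ W^{1,2}(0, T; L²(Ω))` with weak time derivative `φ_τ = φ'`. Here `φ` is the
representative in `C([0, T]; L²(Ω))`, so that the values `φ(·, 0)` and `φ(·, T)` make sense. -/
structure MemW12L2 {N : ℕ} (Ω : Set (Space N)) (T : ℝ) (φ φ' : ℝ → Space N → ℝ) : Prop where
  memCL2 : MemCL2 Ω T φ
  memLp : MemLp (fun z : ℝ × Space N => φ z.1 z.2) 2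
    ((volume.restrict (Ioo 0 T)).prod (volume.restrict Ω))
  memLp_deriv : MemLp (fun z : ℝ × Space N => φ' z.1 z.2) 2
    ((volume.restrict (Ioo 0 T)).prod (volume.restrict Ω))
  weak_deriv : ∀ η : ℝ → ℝ, ContDiff ℝ ∞ η → HasCompactSupport η → tsupport η ⊆ Ioo 0 T →
    ∀ᵐ x ∂(volume.restrict Ω),
      ∫ τ in Ioo 0 T, φ τ x * deriv η τ = - ∫ τ in Ioo 0 T, φ' τ x * η τ

/-- The structural conditions on the kernel `K(x, y, t)`: measurability, symmetry, and
`C₁ ≤ K(x, y, t) |x - y|^{N + ps} ≤ C₂`, almost everywhere in `ℝ^N × ℝ^N × (0, T)`. -/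
structure KernelCond {N : ℕ} (s p C₁ C₂ : ℝ) (T : EReal)
    (K : Space N → Space N → ℝ → ℝ) : Prop where
  aemeasurable : AEMeasurable (fun z : Space N × Space N × ℝ => K z.1 z.2.1 z.2.2)
    (volume.restrict {z | z.2.2 ∈ timeInterval T})
  symmetric : ∀ᵐ z : Space N × Space N × ℝ ∂(volume.restrict {z | z.2.2 ∈ timeInterval T}),
    K z.1 z.2.1 z.2.2 = K z.2.1 z.1 z.2.2
  bounds : ∀ᵐ z : Space N × Space N × ℝ ∂(volume.restrict {z | z.2.2 ∈ timeInterval T}),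
    C₁ ≤ K z.1 z.2.1 z.2.2 * ‖z.1 - z.2.1‖ ^ ((N : ℝ) + p * s) ∧
      K z.1 z.2.1 z.2.2 * ‖z.1 - z.2.1‖ ^ ((N : ℝ) + p * s) ≤ C₂

/-- `∬ |u(x) - u(y)|^{p-2} (u(x) - u(y)) (φ(x) - φ(y)) k(x, y) dx dy` over `ℝ^N × ℝ^N`. -/
def energyForm {N : ℕ} (p : ℝ) (k : Space N → Space N → ℝ) (u φ : Space N → ℝ) : ℝ :=
  ∫ z : Space N × Space N,
    |u z.1 - u z.2| ^ (p - 2) * (u z.1 - u z.2) * (φ z.1 - φ z.2) * k z.1 z.2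

/-- `u` is a weak solution, with a finite time horizon `T`, of the Cauchy-Dirichlet problem
`u_t + L_K u = 0` in `Ω × (0, T)`, `u = 0` in `Ωᶜ × (0, T)`, `u(·, 0) = u₀` in `ℝ^N`.
Elements of `L²(Ω)` are extended by zero to `ℝ^N`, so each `u(·, t)` vanishes outside `Ω`. -/
structure IsWeakSolutionOn {N : ℕ} (s p : ℝ) (Ω : Set (Space N))
    (K : Space N → Space N → ℝ → ℝ) (u₀ : Space N → ℝ) (T : ℝ) (u : ℝ → Space N → ℝ) :
    Prop where
  memCL2 : MemCL2 Ω T u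
  eq_zero : ∀ t ∈ Icc 0 T, ∀ᵐ x ∂(volume.restrict Ωᶜ), u t x = 0
  memLpWsp0 : MemLpWsp0 s p Ω T u
  weak_form : ∀ φ φ' : ℝ → Space N → ℝ, MemW12L2 Ω T φ φ' → MemLpWsp0 s p Ω T φ →
    0 = ((∫ x in Ω, u T x * φ T x) - ∫ x in Ω, u 0 x * φ 0 x)
      - (∫ τ in Ioo 0 T, ∫ x in Ω, u τ x * φ' τ x)
      + ∫ τ in Ioo 0 T, energyForm p (fun x y => K x y τ) (u τ) (φ τ)
  initial : u 0 =ᵐ[volume] u₀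

/-- Weak solutions with a horizon `T ∈ (0, ∞]`: for `T = ∞`, a weak solution on every finite
time interval. -/
def IsWeakSolution {N : ℕ} (s p : ℝ) (Ω : Set (Space N))
    (K : Space N → Space N → ℝ → ℝ) (u₀ : Space N → ℝ) (T : EReal) (u : ℝ → Space N → ℝ) :
    Prop :=
  ∀ S : ℝ, 0 < S → (T = (S : EReal) ∨ T = ⊤) → IsWeakSolutionOn s p Ω K u₀ S u

end FracPLap

end

noncomputable section

namespace FracPLap


/-! Put Y(t) = ∫_Ω u(t)^r, with r = q if p < p_c and r = 2 otherwise. Testing the equation with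
u^{r-1} gives, formally, r⁻¹ Y' + C₁ D ≤ 0, where D is the double integral of `powerDensity`. If D
controls Y^θ for some θ < 1, say Y^θ ≤ A D, then Y' ≤ -(r C₁ / A) Y^θ, and Y reaches zero no later
than A Y(0)^{1-θ} / (r C₁ (1-θ)). The values are θ = 1 - ps/N and θ = p/2 respectively; in both
cases r(1-θ) = 2-p, hence the power of the norm in the extinction time.

The coercivity needs no Sobolev embedding. By Chebyshev, {w > w(x)/2} has measure at most m =
(2/w(x))^r ∫ w^r. So at least half of the ball about x of volume 2m lies where w ≤ w(x)/2, and there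
the density is bounded below. Integration in y bounds w(x)^{p+r-2+rps/N}
(`exists_pointwise_coercivity`), and integration in x bounds its integral by (∫ w^r)^{ps/N} D. For r
= q this exponent is r itself; for r = 2 it is at least 2 exactly when p ≥ p_c, and Jensen's
inequality on Ω finishes, at the price of a power of |Ω|.

A weak solution has no time derivative, so u^{r-1} is cut off to a time window (t₁, t₂] and replaced
by its Steklov averages, which are admissible test functions. In the time term Young's inequality
gives a one-sided estimate that telescopes to r⁻¹(Y(t₁) - Y(t₂)). In the diffusion term the
integrands change sign, but they are dominated by energies that averaging does not increase, so a
Fatou argument (`lintegral_ofReal_le_of_tendsto`) suffices. The outcome is `energy_inequality`, an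
integrated differential inequality, which `eq_zero_of_integral_rpow_le` solves using only continuity
of Y. -/

/-! ### Pointwise coercivity of the energy density -/

/-- The Gagliardo-type density `|w(x)-w(y)|^{p-2}(w(x)-w(y))(w(x)^{r-1}-w(y)^{r-1})/|x-y|^{N+ps}`
obtained by testing the operator with `w^{r-1}`. -/
def powerDensity {N : ℕ} (s p r : ℝ) (w : Space N → ℝ) (x y : Space N) : ℝ :=
  |w x - w y| ^ (p - 2) * (w x - w y) * (w x ^ (r - 1) - w y ^ (r - 1)) /
    ‖x - y‖ ^ ((N : ℝ) + p * s)

theorem sub_mul_rpow_sub_nonneg {a b e : ℝ} (ha : 0 ≤ a) (hb : 0 ≤ b) (he : 0 ≤ e) :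
    0 ≤ (a - b) * (a ^ e - b ^ e) := by
  rcases le_total a b with h | h
  · exact mul_nonneg_of_nonpos_of_nonpos (sub_nonpos.2 h)
      (sub_nonpos.2 (Real.rpow_le_rpow ha h he))
  · exact mul_nonneg (sub_nonneg.2 h) (sub_nonneg.2 (Real.rpow_le_rpow hb h he))

theorem powerDensity_nonneg {N : ℕ} {s p r : ℝ} (hr : 1 ≤ r) {w : Space N → ℝ}
    (hw : ∀ x, 0 ≤ w x) (x y : Space N) : 0 ≤ powerDensity s p r w x y := by
  unfold powerDensity
  have := sub_mul_rpow_sub_nonneg (hw x) (hw y) (sub_nonneg.2 hr)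
  rw [mul_assoc]
  positivity

theorem measurable_powerDensity {N : ℕ} {s p r : ℝ} {w : Space N → ℝ} (hw : Measurable w) :
    Measurable (fun z : Space N × Space N => powerDensity s p r w z.1 z.2) := by
  unfold powerDensity
  have h1 : Measurable (fun z : Space N × Space N => w z.1) := hw.comp measurable_fst
  have h2 : Measurable (fun z : Space N × Space N => w z.2) := hw.comp measurable_snd
  have h3 : Measurable (fun z : Space N × Space N => ‖z.1 - z.2‖) := by fun_prop
  exact ((((h1.sub h2).norm.pow_const _).mul (h1.sub h2)).mul
    ((h1.pow_const _).sub (h2.pow_const _))).div (h3.pow_const _)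

/-- Lower bound of the density at points where `w` has dropped by a factor two. -/
theorem le_powerDensity_of_le_half {N : ℕ} {s p r : ℝ} (hs : 0 < s) (hp : 1 < p) (hr : 1 < r)
    {w : Space N → ℝ} (hw : ∀ x, 0 ≤ w x) {x y : Space N} {R : ℝ}
    (hx : 0 < w x) (hy : w y ≤ w x / 2) (hxy : ‖x - y‖ ≤ R) :
    (1 / 2) ^ (p - 1) * (1 - (1 / 2) ^ (r - 1)) * w x ^ (p + r - 2) / R ^ ((N : ℝ) + p * s) ≤
      powerDensity s p r w x y := by
  unfold powerDensity
  have hne : x ≠ y := by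
    rintro rfl
    linarith
  have hn : 0 < ‖x - y‖ := norm_pos_iff.2 (sub_ne_zero.2 hne)
  have hd : 0 < w x - w y := by linarith
  have e1 : |w x - w y| ^ (p - 2) * (w x - w y) = (w x - w y) ^ (p - 1) := by
    rw [abs_of_pos hd]
    nth_rewrite 2 [← Real.rpow_one (w x - w y)]
    rw [← Real.rpow_add hd]
    congr 1; ring
  rw [e1]
  have h1 : (1 / 2) ^ (p - 1) * w x ^ (p - 1) ≤ (w x - w y) ^ (p - 1) := by
    rw [← Real.mul_rpow (by norm_num) hx.le]
    exact Real.rpow_le_rpow (by positivity) (by linarith) (by linarith)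
  have h2 : (1 - (1 / 2) ^ (r - 1)) * w x ^ (r - 1) ≤ w x ^ (r - 1) - w y ^ (r - 1) := by
    have : w y ^ (r - 1) ≤ (1 / 2) ^ (r - 1) * w x ^ (r - 1) := by
      rw [← Real.mul_rpow (by norm_num) hx.le]
      exact Real.rpow_le_rpow (hw y) (by linarith) (by linarith)
    linarith
  have h0 : 0 < 1 - (1 / 2 : ℝ) ^ (r - 1) := by
    have := Real.rpow_lt_one (x := (1 / 2 : ℝ)) (by norm_num) (by norm_num) (sub_pos.2 hr)
    linarith
  have e2 : w x ^ (p + r - 2) = w x ^ (p - 1) * w x ^ (r - 1) := by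
    rw [← Real.rpow_add hx]; congr 1; ring
  have hex : 0 ≤ (N : ℝ) + p * s := by positivity
  apply div_le_div₀
  · exact mul_nonneg (by positivity) (by
      have := Real.rpow_le_rpow (hw y) (by linarith : w y ≤ w x) (by linarith : 0 ≤ r - 1)
      linarith)
  · calc _ = ((1 / 2) ^ (p - 1) * w x ^ (p - 1)) *
          ((1 - (1 / 2) ^ (r - 1)) * w x ^ (r - 1)) := by rw [e2]; ring
      _ ≤ _ := mul_le_mul h1 h2 (by positivity) (by positivity)
  · exact Real.rpow_pos_of_pos hn _
  · exact Real.rpow_le_rpow hn.le hxy hex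

/-- Pointwise coercivity: the density integrated in `y` controls a power of `w x`. -/
theorem exists_pointwise_coercivity (N : ℕ) (hN : 1 ≤ N) {s p r : ℝ} (hs : 0 < s) (hp : 1 < p)
    (hr : 1 < r) :
    ∃ C : ℝ, 0 < C ∧ ∀ w : Space N → ℝ, Measurable w → (∀ x, 0 ≤ w x) →
      ∀ I : ℝ, 0 < I → ∫⁻ y, ENNReal.ofReal (w y ^ r) ≤ ENNReal.ofReal I → ∀ x,
      ENNReal.ofReal (w x ^ (p + r - 2 + r * (p * s / N))) ≤
        ENNReal.ofReal (C * I ^ (p * s / N)) *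
          ∫⁻ y, ENNReal.ofReal (powerDensity s p r w x y) := by
  have hNpos : (0 : ℝ) < N := by exact_mod_cast hN
  obtain ⟨V, hV, hVe⟩ : ∃ V : ℝ, 0 < V ∧
      volume (Metric.ball (0 : Space N) 1) = ENNReal.ofReal V := by
    refine ⟨(volume (Metric.ball (0 : Space N) 1)).toReal, ?_, ?_⟩
    · exact ENNReal.toReal_pos (Metric.measure_ball_pos _ _ one_pos).ne' measure_ball_lt_top.ne
    · rw [ENNReal.ofReal_toReal measure_ball_lt_top.ne]
  set c₀ : ℝ := (1 / 2) ^ (p - 1) * (1 - (1 / 2) ^ (r - 1)) with hc₀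
  have hc₀pos : 0 < c₀ := by
    have := Real.rpow_lt_one (x := (1 / 2 : ℝ)) (by norm_num) (by norm_num) (sub_pos.2 hr)
    exact mul_pos (by positivity) (by linarith)
  -- The constant that turns the final comparison into an equality: it is the reciprocal of `κ * m`
  -- stripped of its powers of `I` and `w x`.
  refine ⟨2 / (c₀ * V) * (2 * 2 ^ r / V) ^ (p * s / N), by positivity, ?_⟩
  intro w hwm hw I hI hwI x
  rcases (hw x).eq_or_lt with h0 | hx
  · have hex : 0 < r * (p * s / N) := by positivity
    rw [← h0, Real.zero_rpow (by linarith), ENNReal.ofReal_zero]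
    exact zero_le
  set a := w x with ha
  -- `m` is the Chebyshev bound for the measure of {w > a/2}, and `R` is chosen so that a ball of
  -- radius `R` has volume `2 * m`.
  set m : ℝ := I * (2 / a) ^ r with hm
  have hmpos : 0 < m := by positivity
  set R : ℝ := (2 * m / V) ^ (1 / (N : ℝ)) with hRdef
  have hR : 0 < R := by positivity
  have hRN : V * R ^ N = 2 * m := by
    rw [hRdef, ← Real.rpow_natCast, ← Real.rpow_mul (by positivity), one_div,
      inv_mul_cancel₀ hNpos.ne', Real.rpow_one]
    field_simp
  set B : Set (Space N) := {y | a / 2 < w y} with hB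
  have hBm : MeasurableSet B := measurableSet_lt measurable_const hwm
  have hBvol : volume B ≤ ENNReal.ofReal m := by
    have hcheb := mul_meas_ge_le_lintegral (μ := (volume : Measure (Space N)))
      (f := fun y => ENNReal.ofReal (w y ^ r)) (by fun_prop) (ENNReal.ofReal ((a / 2) ^ r))
    have hsub : B ⊆ {y | ENNReal.ofReal ((a / 2) ^ r) ≤ ENNReal.ofReal (w y ^ r)} := by
      intro y hy
      exact ENNReal.ofReal_le_ofReal (Real.rpow_le_rpow (by positivity) (le_of_lt hy) (by linarith))
    have h1 : ENNReal.ofReal ((a / 2) ^ r) * volume B ≤ ENNReal.ofReal I :=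
      (mul_le_mul_right (measure_mono hsub) _).trans (hcheb.trans hwI)
    have hpos : 0 < (a / 2) ^ r := by positivity
    have e : m = I / (a / 2) ^ r := by
      rw [hm, Real.div_rpow (by norm_num) hx.le, Real.div_rpow hx.le (by norm_num)]
      field_simp
    rw [e, ENNReal.ofReal_div_of_pos hpos, ENNReal.le_div_iff_mul_le
      (Or.inl (by simpa using hpos)) (Or.inl ENNReal.ofReal_ne_top), mul_comm]
    exact h1
  -- Removing `B` costs at most half of the ball, so `A` keeps measure at least `m`; on `A` the
  -- function has dropped by a factor two.
  set A : Set (Space N) := Metric.ball x R \ B with hA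
  have hAm : MeasurableSet A := measurableSet_ball.diff hBm
  have hball : volume (Metric.ball x R) = ENNReal.ofReal (2 * m) := by
    rw [Measure.addHaar_ball_of_pos _ _ hR, hVe, finrank_euclideanSpace_fin,
      ← ENNReal.ofReal_mul (by positivity), mul_comm, hRN]
  have hAvol : ENNReal.ofReal m ≤ volume A := by
    have h1 : volume (Metric.ball x R) - volume B ≤ volume A := le_measure_sdiff
    refine le_trans ?_ h1
    rw [hball]
    calc ENNReal.ofReal m = ENNReal.ofReal (2 * m) - ENNReal.ofReal m := by
          rw [← ENNReal.ofReal_sub _ hmpos.le]; congr 1; ring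
      _ ≤ _ := tsub_le_tsub_left hBvol _
  set κ : ℝ := c₀ * a ^ (p + r - 2) / R ^ ((N : ℝ) + p * s) with hκ
  have hκpos : 0 < κ := by positivity
  have hlow : ENNReal.ofReal (κ * m) ≤ ∫⁻ y, ENNReal.ofReal (powerDensity s p r w x y) := by
    calc ENNReal.ofReal (κ * m) = ENNReal.ofReal κ * ENNReal.ofReal m :=
          ENNReal.ofReal_mul hκpos.le
      _ ≤ ENNReal.ofReal κ * volume A := by gcongr
      _ = ∫⁻ _ in A, ENNReal.ofReal κ := by rw [setLIntegral_const]
      _ ≤ ∫⁻ y in A, ENNReal.ofReal (powerDensity s p r w x y) := by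
          refine setLIntegral_mono' hAm fun y hy => ENNReal.ofReal_le_ofReal ?_
          have hy1 : ‖x - y‖ ≤ R := by
            have := hy.1
            rw [Metric.mem_ball, dist_comm, dist_eq_norm] at this
            exact this.le
          exact le_powerDensity_of_le_half hs hp hr hw hx (not_lt.1 hy.2) hy1
      _ ≤ _ := setLIntegral_le_lintegral _ _
  have hC : 0 < 2 / (c₀ * V) * (2 * 2 ^ r / V) ^ (p * s / N) * I ^ (p * s / N) := by positivity
  refine le_trans ?_ (mul_le_mul_right hlow _)
  rw [← ENNReal.ofReal_mul hC.le]
  refine ENNReal.ofReal_le_ofReal (le_of_eq ?_)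
  have hRps : R ^ ((N : ℝ) + p * s) = (2 * m / V) * (2 * m / V) ^ (p * s / N) := by
    rw [hRdef, ← Real.rpow_mul (by positivity), ← Real.rpow_one_add' (by positivity)
      (by positivity)]
    congr 1; field_simp
  have hm2 : (2 * m / V) ^ (p * s / N) =
      (2 * 2 ^ r / V) ^ (p * s / N) * I ^ (p * s / N) / a ^ (r * (p * s / N)) := by
    rw [Real.rpow_mul hx.le, ← Real.mul_rpow (by positivity) (by positivity),
      ← Real.div_rpow (by positivity) (by positivity)]
    congr 1
    rw [hm, Real.div_rpow (by norm_num) hx.le]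
    field_simp
  rw [hκ, hRps, hm2, Real.rpow_add hx]
  field_simp


/-! ### Extinction for an integral inequality -/

/-- An integral inequality on compact subintervals of `(0, S)` extends to `[0, S]`. -/
theorem integral_le_sub_of_forall_Ioo {y Y : ℝ → ℝ} {S : ℝ} (hS : 0 < S)
    (hy : ContinuousOn y (Icc 0 S)) (hY : ContinuousOn Y (Icc 0 S))
    (h : ∀ t₁ t₂, 0 < t₁ → t₁ < t₂ → t₂ < S → ∫ t in t₁..t₂, y t ≤ Y t₁ - Y t₂)
    {t₁ t₂ : ℝ} (h₁ : 0 ≤ t₁) (h₁₂ : t₁ < t₂) (h₂ : t₂ ≤ S) :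
    ∫ t in t₁..t₂, y t ≤ Y t₁ - Y t₂ := by
  have hint : IntervalIntegrable y volume 0 S := hy.intervalIntegrable_of_Icc hS.le
  set J : ℝ → ℝ := fun x => ∫ t in (0 : ℝ)..x, y t with hJ
  have hJc : ContinuousOn J (Icc 0 S) := by
    have := intervalIntegral.continuousOn_primitive_interval (μ := volume) (a := 0) (b := S) (f := y)
      (by rw [uIcc_of_le hS.le]; exact hy.integrableOn_Icc)
    rwa [uIcc_of_le hS.le] at this
  have hsub : ∀ a b, a ∈ Icc 0 S → b ∈ Icc 0 S → ∫ t in a..b, y t = J b - J a := by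
    intro a b ha hb
    rw [hJ]
    simp only
    rw [intervalIntegral.integral_interval_sub_left]
    · exact hint.mono_set (by rw [uIcc_of_le hS.le, uIcc_of_le hb.1]; exact Icc_subset_Icc_right hb.2)
    · exact hint.mono_set (by rw [uIcc_of_le hS.le, uIcc_of_le ha.1]; exact Icc_subset_Icc_right ha.2)
  have hG : ContinuousOn (fun x => J x + Y x) (Icc 0 S) := hJc.add hY
  -- The inequality says that J + Y is nonincreasing on the open interval. Continuity then carries
  -- this to the left endpoint (`hstep`) and afterwards to the right one (`hanti'`).
  have hanti : AntitoneOn (fun x => J x + Y x) (Ioo 0 S) := by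
    intro a ha b hb hab
    rcases hab.eq_or_lt with rfl | hab
    · exact le_rfl
    have := h a b ha.1 hab hb.2
    rw [hsub a b ⟨ha.1.le, ha.2.le⟩ ⟨hb.1.le, hb.2.le⟩] at this
    simp only; linarith
  have hstep : ∀ b ∈ Ioo 0 S, ∀ a ∈ Icc 0 b, J b + Y b ≤ J a + Y a := by
    intro b hb a ha
    have hcl : closure (Ioo 0 b) = Icc 0 b := closure_Ioo hb.1.ne
    refine le_on_closure (s := Ioo 0 b) (f := fun _ => J b + Y b) (g := fun x => J x + Y x)
      (fun x hx => hanti ⟨hx.1, hx.2.trans hb.2⟩ hb hx.2.le) continuousOn_const ?_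
      (by rwa [hcl])
    rw [hcl]
    exact hG.mono (Icc_subset_Icc_right hb.2.le)
  have hanti' : J t₂ + Y t₂ ≤ J t₁ + Y t₁ := by
    have hcl : closure (Ioo t₁ S) = Icc t₁ S := closure_Ioo (h₁₂.trans_le h₂).ne
    refine le_on_closure (s := Ioo t₁ S) (f := fun x => J x + Y x) (g := fun _ => J t₁ + Y t₁)
      (fun x hx => hstep x ⟨h₁.trans_lt hx.1, hx.2⟩ t₁ ⟨h₁, hx.1.le⟩) ?_ continuousOn_const
      (by rw [hcl]; exact ⟨h₁₂.le, h₂⟩)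
    rw [hcl]
    exact hG.mono (Icc_subset_Icc_left h₁)
  have ha : t₁ ∈ Icc 0 S := ⟨h₁, by linarith⟩
  have hb : t₂ ∈ Icc 0 S := ⟨by linarith, h₂⟩
  rw [hsub t₁ t₂ ha hb]
  linarith

/-- Extinction in finite time for the integral inequality `∫ Y^θ ≤ B (Y(t₁) - Y(t₂))`. -/
theorem eq_zero_of_integral_rpow_le {Y : ℝ → ℝ} {S B θ : ℝ} (hS : 0 < S) (hθ : 0 < θ)
    (hθ1 : θ < 1) (hB : 0 ≤ B) (hY : ContinuousOn Y (Icc 0 S)) (hY0 : ∀ t ∈ Icc 0 S, 0 ≤ Y t)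
    (h : ∀ t₁ t₂, 0 < t₁ → t₁ < t₂ → t₂ < S → ∫ t in t₁..t₂, Y t ^ θ ≤ B * (Y t₁ - Y t₂))
    {t : ℝ} (ht0 : 0 < t) (htS : t ≤ S) (ht : B * Y 0 ^ (1 - θ) / (1 - θ) < t) : Y t = 0 := by
  by_contra hne
  have hYt : 0 < Y t := lt_of_le_of_ne (hY0 t ⟨ht0.le, htS⟩) (Ne.symm hne)
  have hθ' : 0 < 1 - θ := by linarith
  have hYθ : ContinuousOn (fun x => Y x ^ θ) (Icc 0 S) :=
    hY.rpow_const fun x _ => Or.inr hθ.le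
  have hext : ∀ t₁ t₂, 0 ≤ t₁ → t₁ < t₂ → t₂ ≤ S →
      ∫ t in t₁..t₂, Y t ^ θ ≤ B * Y t₁ - B * Y t₂ := fun t₁ t₂ a b c =>
    integral_le_sub_of_forall_Ioo (Y := fun x => B * Y x) hS hYθ (continuousOn_const.mul hY)
      (fun t₁ t₂ a b c => by have := h t₁ t₂ a b c; linarith) a b c
  have hsubI : Icc 0 t ⊆ Icc 0 S := Icc_subset_Icc_right htS
  have hint : IntervalIntegrable (fun x => Y x ^ θ) volume 0 t :=
    (hYθ.mono hsubI).intervalIntegrable_of_Icc ht0.le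
  -- Y is only continuous, so the differential inequality is run on `W`, which is differentiable in
  -- the interior with W' = -Y^θ and satisfies W ≤ B Y.
  set W : ℝ → ℝ := fun x => ∫ τ in x..t, Y τ ^ θ with hW
  have hBpos : 0 < B := by
    rcases hB.eq_or_lt with h0 | h0
    · exfalso
      have h1 := hext 0 t le_rfl ht0 htS
      have h2 : 0 < ∫ τ in (0 : ℝ)..t, Y τ ^ θ := by
        refine intervalIntegral.integral_pos ht0 (hYθ.mono hsubI) (fun x hx =>
          Real.rpow_nonneg (hY0 x (hsubI ⟨hx.1.le, hx.2⟩)) _) ⟨t, ⟨ht0.le, le_rfl⟩, ?_⟩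
        positivity
      rw [← h0] at h1
      linarith
    · exact h0
  have hYpos : ∀ x ∈ Icc 0 t, 0 < Y x := by
    intro x hx
    rcases hx.2.eq_or_lt with rfl | hlt
    · exact hYt
    have h1 := hext x t hx.1 hlt htS
    have h2 : 0 ≤ ∫ τ in x..t, Y τ ^ θ := intervalIntegral.integral_nonneg hx.2
      fun y hy => Real.rpow_nonneg (hY0 y (hsubI ⟨hx.1.trans hy.1, hy.2⟩)) _
    have h3 : B * Y t ≤ B * Y x := by linarith
    exact hYt.trans_le (le_of_mul_le_mul_left h3 hBpos)
  have hWle : ∀ x ∈ Ico 0 t, W x ≤ B * Y x := by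
    intro x hx
    have h1 := hext x t hx.1 hx.2 htS
    have : 0 ≤ B * Y t := by positivity
    simp only [hW]; linarith
  have hWpos : ∀ x ∈ Ico 0 t, 0 < W x := by
    intro x hx
    refine intervalIntegral.integral_pos hx.2 ((hYθ.mono hsubI).mono (Icc_subset_Icc_left hx.1))
      (fun y hy => Real.rpow_nonneg (hY0 y (hsubI ⟨hx.1.trans hy.1.le, hy.2⟩)) _)
      ⟨t, ⟨hx.2.le, le_rfl⟩, by positivity⟩
  have hWc : ContinuousOn W (Icc 0 t) := by
    have := intervalIntegral.continuousOn_primitive_interval_left (μ := volume) (a := 0) (b := t)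
      (f := fun x => Y x ^ θ) (by rw [uIcc_of_le ht0.le]; exact (hYθ.mono hsubI).integrableOn_Icc)
    rwa [uIcc_of_le ht0.le] at this
  have hWd : ∀ x ∈ Ioo 0 t, HasDerivAt W (-(Y x ^ θ)) x := by
    intro x hx
    have hnhds : Icc 0 S ∈ 𝓝 x := Icc_mem_nhds hx.1 (hx.2.trans_le htS)
    refine intervalIntegral.integral_hasDerivAt_left
      (hint.mono_set ?_) ?_ (hYθ.continuousAt hnhds)
    · rw [uIcc_of_le ht0.le, uIcc_of_le hx.2.le]; exact Icc_subset_Icc_left hx.1.le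
    · exact ContinuousOn.stronglyMeasurableAtFilter_nhdsWithin hYθ measurableSet_Icc x |>.filter_mono
        (by rw [nhdsWithin_eq_nhds.2 hnhds])
  have hZc : ContinuousOn (fun x => W x ^ (1 - θ)) (Icc 0 t) :=
    hWc.rpow_const fun x _ => Or.inr hθ'.le
  have hZd : ∀ x ∈ Ioo 0 t, HasDerivAt (fun x => W x ^ (1 - θ))
      (-(Y x ^ θ) * (1 - θ) * W x ^ (1 - θ - 1)) x := fun x hx =>
    (hWd x hx).rpow_const (Or.inl (hWpos x ⟨hx.1.le, hx.2⟩).ne')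
  -- From W ≤ B Y, the function W^{1-θ} decreases at rate at least (1-θ) B^{-θ}. It vanishes at t,
  -- so the mean value theorem gives (1-θ) t ≤ B Y(0)^{1-θ}, contradicting `ht`.
  obtain ⟨x, hx, hxe⟩ := exists_hasDerivAt_eq_slope _ _ ht0 hZc hZd
  have hWt : W t = 0 := intervalIntegral.integral_same
  have hx' : x ∈ Ico 0 t := ⟨hx.1.le, hx.2⟩
  have hWx := hWpos x hx'
  have hYx := hYpos x ⟨hx.1.le, hx.2.le⟩
  have hkey : (B ^ θ)⁻¹ ≤ Y x ^ θ * W x ^ (1 - θ - 1) := by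
    have e : (1 - θ - 1) = -θ := by ring
    rw [e, Real.rpow_neg hWx.le]
    have : W x ^ θ ≤ B ^ θ * Y x ^ θ := by
      rw [← Real.mul_rpow hBpos.le hYx.le]
      exact Real.rpow_le_rpow hWx.le (hWle x hx') hθ.le
    rw [inv_le_iff_one_le_mul₀ (by positivity), ← div_eq_mul_inv, div_mul_eq_mul_div,
      one_le_div (by positivity)]
    linarith
  simp only [hWt, sub_zero] at hxe
  rw [Real.zero_rpow hθ'.ne', zero_sub, eq_div_iff ht0.ne'] at hxe
  have h0 : (0 : ℝ) ∈ Ico 0 t := ⟨le_rfl, ht0⟩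
  have hW0 : W 0 ^ (1 - θ) ≤ (B * Y 0) ^ (1 - θ) :=
    Real.rpow_le_rpow (hWpos 0 h0).le (hWle 0 h0) hθ'.le
  rw [Real.mul_rpow hBpos.le (hYpos 0 ⟨le_rfl, ht0.le⟩).le] at hW0
  have h3 : (B ^ θ)⁻¹ * ((1 - θ) * t) ≤ B ^ (1 - θ) * Y 0 ^ (1 - θ) := by
    calc _ ≤ Y x ^ θ * W x ^ (1 - θ - 1) * ((1 - θ) * t) := by gcongr
      _ = W 0 ^ (1 - θ) := by linarith
      _ ≤ _ := hW0
  have hBB : B ^ θ * B ^ (1 - θ) = B := by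
    rw [← Real.rpow_add hBpos]; simp
  have h4 : (1 - θ) * t ≤ B * Y 0 ^ (1 - θ) := by
    calc (1 - θ) * t = B ^ θ * ((B ^ θ)⁻¹ * ((1 - θ) * t)) := by
          rw [← mul_assoc, mul_inv_cancel₀ (by positivity), one_mul]
      _ ≤ B ^ θ * (B ^ (1 - θ) * Y 0 ^ (1 - θ)) := by gcongr
      _ = _ := by rw [← mul_assoc, hBB]
  rw [div_lt_iff₀ hθ'] at ht
  linarith


/-! ### Steklov averages as test functions -/

/-- The forward Steklov average `h⁻¹ ∫₀ʰ g(t + σ) dσ`. -/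
def steklov (h : ℝ) (g : ℝ → ℝ) (t : ℝ) : ℝ := h⁻¹ * ∫ σ in (0 : ℝ)..h, g (t + σ)

theorem steklov_eq (h : ℝ) (g : ℝ → ℝ) (t : ℝ) :
    steklov h g t = h⁻¹ * ∫ τ in t..(t + h), g τ := by
  rw [steklov, intervalIntegral.integral_comp_add_left, add_zero]

theorem intervalIntegrable_of_bounded {g : ℝ → ℝ} {M : ℝ} (hg : Measurable g)
    (hM : ∀ t, |g t| ≤ M) (a b : ℝ) : IntervalIntegrable g volume a b := by
  refine (intervalIntegrable_const (c := M)).mono_fun hg.aestronglyMeasurable ?_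
  refine Eventually.of_forall fun t => ?_
  simpa using (hM t).trans (le_abs_self M)

theorem locallyIntegrable_of_bounded {g : ℝ → ℝ} {M : ℝ} (hg : Measurable g)
    (hM : ∀ t, |g t| ≤ M) : LocallyIntegrable g volume :=
  (locallyIntegrable_const M).mono hg.aestronglyMeasurable
    (Eventually.of_forall fun t => by simpa using (hM t).trans (le_abs_self M))

theorem abs_steklov_le {h M : ℝ} {g : ℝ → ℝ} (hh : 0 < h) (hM : ∀ t, |g t| ≤ M) (t : ℝ) :
    |steklov h g t| ≤ M := by
  have h1 := intervalIntegral.norm_integral_le_of_norm_le_const (a := 0) (b := h)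
    (f := fun σ => g (t + σ)) (C := M) (fun σ _ => hM _)
  rw [Real.norm_eq_abs, sub_zero, abs_of_pos hh] at h1
  rw [steklov, abs_mul, abs_of_pos (inv_pos.2 hh), inv_mul_le_iff₀ hh, mul_comm]
  exact h1

theorem steklov_sub {h M M' : ℝ} {f g : ℝ → ℝ} (hf : Measurable f) (hg : Measurable g)
    (hM : ∀ t, |f t| ≤ M) (hM' : ∀ t, |g t| ≤ M') (t : ℝ) :
    steklov h (fun τ => f τ - g τ) t = steklov h f t - steklov h g t := by
  simp only [steklov_eq]
  rw [intervalIntegral.integral_sub (intervalIntegrable_of_bounded hf hM _ _)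
    (intervalIntegrable_of_bounded hg hM' _ _)]
  ring

theorem steklov_eq_zero {h t : ℝ} {g : ℝ → ℝ} (hh : 0 < h)
    (hg : ∀ τ, t < τ → τ ≤ t + h → g τ = 0) :
    steklov h g t = 0 := by
  rw [steklov_eq, intervalIntegral.integral_of_le (by linarith),
    setIntegral_congr_fun measurableSet_Ioc (g := fun _ => (0 : ℝ)) fun τ hτ => hg τ hτ.1 hτ.2]
  simp

/-- The windows starting at t and t' differ by two intervals of length |t - t'|, each contributing
at most M |t - t'|. -/
theorem abs_steklov_sub_le {h M : ℝ} {g : ℝ → ℝ} (hh : 0 < h) (hg : Measurable g)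
    (hM : ∀ t, |g t| ≤ M) (t t' : ℝ) :
    |steklov h g t - steklov h g t'| ≤ 2 * M / h * |t - t'| := by
  have hi := fun a b => intervalIntegrable_of_bounded hg hM a b
  have e : steklov h g t - steklov h g t' =
      h⁻¹ * ((∫ τ in t..t', g τ) - ∫ τ in (t + h)..(t' + h), g τ) := by
    rw [steklov_eq, steklov_eq, ← mul_sub,
      intervalIntegral.integral_interval_sub_interval_comm (hi _ _) (hi _ _) (hi _ _)]
  have b1 := intervalIntegral.norm_integral_le_of_norm_le_const (a := t) (b := t')
    (f := g) (C := M) (fun σ _ => hM _)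
  have b2 := intervalIntegral.norm_integral_le_of_norm_le_const (a := t + h) (b := t' + h)
    (f := g) (C := M) (fun σ _ => hM _)
  rw [add_sub_add_right_eq_sub] at b2
  rw [e, abs_mul, abs_of_pos (inv_pos.2 hh), div_mul_eq_mul_div, inv_mul_le_iff₀ hh,
    mul_div_cancel₀ _ hh.ne']
  refine (abs_sub _ _).trans ?_
  rw [Real.norm_eq_abs, abs_sub_comm t'] at b1 b2
  linarith

/-- Lebesgue differentiation is needed both at t and at t + h; the second exceptional set is a
translate of a null set. -/
theorem ae_hasDerivAt_steklov {h M : ℝ} {g : ℝ → ℝ} (hg : Measurable g) (hM : ∀ t, |g t| ≤ M) :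
    ∀ᵐ t, HasDerivAt (steklov h g) (h⁻¹ * (g (t + h) - g t)) t := by
  have h1 := LocallyIntegrable.ae_hasDerivAt_integral (locallyIntegrable_of_bounded hg hM)
  have h2 : ∀ᵐ t, ∀ c, HasDerivAt (fun x => ∫ τ in c..x, g τ) (g (t + h)) (t + h) :=
    (measurePreserving_add_right (volume : Measure ℝ) h).quasiMeasurePreserving.ae h1
  have hi := fun a b => intervalIntegrable_of_bounded hg hM a b
  filter_upwards [h1, h2] with t ht1 ht2
  have h3 := (ht2 0).comp_add_const t h
  have h4 := (h3.sub (ht1 0)).const_mul h⁻¹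
  refine h4.congr_of_eventuallyEq (Eventually.of_forall fun x => ?_)
  rw [steklov_eq]
  simp only [Pi.sub_apply]
  rw [intervalIntegral.integral_interval_sub_left (hi _ _) (hi _ _)]

theorem ae_tendsto_steklov {M : ℝ} {g : ℝ → ℝ} (hg : Measurable g) (hM : ∀ t, |g t| ≤ M) :
    ∀ᵐ t, Tendsto (fun h => steklov h g t) (𝓝[>] 0) (𝓝 (g t)) := by
  have hi := fun a b => intervalIntegrable_of_bounded hg hM a b
  filter_upwards [LocallyIntegrable.ae_hasDerivAt_integral (locallyIntegrable_of_bounded hg hM)] with t ht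
  have h1 := (ht 0).tendsto_slope_zero_right
  refine h1.congr fun h => ?_
  rw [steklov_eq, intervalIntegral.integral_interval_sub_left (hi _ _) (hi _ _), smul_eq_mul]

/-- Integration by parts: `h⁻¹ (g(t + h) - g(t))` is the weak derivative of the average. -/
theorem integral_steklov_mul_deriv {h M S : ℝ} {g : ℝ → ℝ} (hh : 0 < h) (hS : 0 < S)
    (hg : Measurable g) (hM : ∀ t, |g t| ≤ M) {η : ℝ → ℝ} (hη : ContDiff ℝ ∞ η)
    (hsupp : tsupport η ⊆ Ioo 0 S) :
    ∫ τ in Ioo 0 S, steklov h g τ * deriv η τ =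
      - ∫ τ in Ioo 0 S, h⁻¹ * (g (τ + h) - g τ) * η τ := by
  have hM0 : 0 ≤ M := (abs_nonneg _).trans (hM 0)
  -- Lipschitz functions are absolutely continuous, so integration by parts holds although the
  -- average need not be differentiable everywhere.
  have hlip : LipschitzOnWith (2 * M / h).toNNReal (steklov h g) (uIcc 0 S) := by
    refine LipschitzOnWith.of_dist_le_mul fun x _ y _ => ?_
    rw [Real.dist_eq, Real.dist_eq, Real.coe_toNNReal _ (by positivity)]
    exact abs_steklov_sub_le hh hg hM x y
  have hac := hlip.absolutelyContinuousOnInterval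
  have hηac : AbsolutelyContinuousOnInterval η 0 S :=
    ((hη.of_le (by exact_mod_cast le_top)).contDiffOn (n := 1)).absolutelyContinuousOnInterval
  have hibp := hac.integral_mul_deriv_eq_deriv_mul hηac
  have h0 : η 0 = 0 := image_eq_zero_of_notMem_tsupport fun hm => (hsupp hm).1.false
  have h1 : η S = 0 := image_eq_zero_of_notMem_tsupport fun hm => (hsupp hm).2.false
  rw [h0, h1, mul_zero, mul_zero, sub_zero, zero_sub] at hibp
  rw [← integral_Ioc_eq_integral_Ioo, ← integral_Ioc_eq_integral_Ioo,
    ← intervalIntegral.integral_of_le hS.le, ← intervalIntegral.integral_of_le hS.le, hibp]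
  congr 1
  refine intervalIntegral.integral_congr_ae ?_
  filter_upwards [ae_hasDerivAt_steklov (h := h) hg hM] with t ht _
  rw [ht.deriv]

/-- Steklov averaging is a contraction in `L^p`. -/
theorem lintegral_steklov_rpow_le {h M p : ℝ} {g : ℝ → ℝ} (hh : 0 < h) (hp : 1 ≤ p)
    (hg : Measurable g) (hM : ∀ t, |g t| ≤ M) :
    ∫⁻ t, ENNReal.ofReal (|steklov h g t| ^ p) ≤ ∫⁻ t, ENNReal.ofReal (|g t| ^ p) := by
  have hM0 : 0 ≤ M := (abs_nonneg _).trans (hM 0)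
  -- Jensen over the averaging window; Tonelli and translation invariance in t then remove the shift
  -- σ.
  have hjensen : ∀ t, ENNReal.ofReal (|steklov h g t| ^ p) ≤
      ENNReal.ofReal h⁻¹ * ∫⁻ σ in Ioc 0 h, ENNReal.ofReal (|g (t + σ)| ^ p) := by
    intro t
    have hm : Measurable fun σ => g (t + σ) := hg.comp (measurable_const_add t)
    have hint : IntegrableOn (fun σ => |g (t + σ)|) (Ioc 0 h) :=
      ((intervalIntegrable_iff_integrableOn_Ioc_of_le hh.le).1
        (intervalIntegrable_of_bounded hm (fun σ => hM _) 0 h)).norm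
    have hint2 : IntegrableOn (fun σ => |g (t + σ)| ^ p) (Ioc 0 h) :=
      (intervalIntegrable_iff_integrableOn_Ioc_of_le hh.le).1
        (intervalIntegrable_of_bounded (M := M ^ p) (by fun_prop) (fun σ => by
          rw [abs_of_nonneg (by positivity)]
          exact Real.rpow_le_rpow (abs_nonneg _) (hM _) (by linarith)) 0 h)
    have hvol : volume (Ioc 0 h) = ENNReal.ofReal h := by simp
    have hJ := (convexOn_rpow hp).map_set_average_le (μ := volume) (t := Ioc 0 h)
      (f := fun σ => |g (t + σ)|)
      (continuousOn_id.rpow_const fun x _ => Or.inr (by linarith)) isClosed_Ici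
      (by rw [hvol]; simpa using hh) (by rw [hvol]; simp)
      (Eventually.of_forall fun σ => mem_Ici.2 (abs_nonneg _)) hint hint2
    have hreal : (volume.real (Ioc 0 h)) = h := by simp [hh.le]
    rw [setAverage_eq, setAverage_eq, hreal, smul_eq_mul, smul_eq_mul] at hJ
    rw [← ofReal_integral_eq_lintegral_ofReal hint2
      (Eventually.of_forall fun σ => by positivity), ← ENNReal.ofReal_mul (by positivity)]
    refine ENNReal.ofReal_le_ofReal (le_trans ?_ hJ)
    refine Real.rpow_le_rpow (abs_nonneg _) ?_ (by linarith)
    rw [steklov, abs_mul, abs_of_pos (inv_pos.2 hh)]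
    gcongr
    rw [intervalIntegral.integral_of_le hh.le]
    exact abs_integral_le_integral_abs
  calc _ ≤ ∫⁻ t, ENNReal.ofReal h⁻¹ * ∫⁻ σ in Ioc 0 h, ENNReal.ofReal (|g (t + σ)| ^ p) :=
        lintegral_mono hjensen
    _ = ENNReal.ofReal h⁻¹ * ∫⁻ t, ∫⁻ σ in Ioc 0 h, ENNReal.ofReal (|g (t + σ)| ^ p) :=
        lintegral_const_mul' _ _ ENNReal.ofReal_ne_top
    _ = ENNReal.ofReal h⁻¹ * ∫⁻ σ in Ioc 0 h, ∫⁻ t, ENNReal.ofReal (|g (t + σ)| ^ p) := by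
        rw [lintegral_lintegral_swap]
        have : Measurable fun z : ℝ × ℝ => g (z.1 + z.2) := hg.comp (by fun_prop)
        exact (by fun_prop : Measurable fun z : ℝ × ℝ =>
          ENNReal.ofReal (|g (z.1 + z.2)| ^ p)).aemeasurable
    _ = ENNReal.ofReal h⁻¹ * ∫⁻ σ in Ioc 0 h, ∫⁻ t, ENNReal.ofReal (|g t| ^ p) := by
        congr 1
        refine lintegral_congr fun σ => ?_
        exact lintegral_add_right_eq_self (fun t => ENNReal.ofReal (|g t| ^ p)) σ
    _ = _ := by
        rw [setLIntegral_const, Real.volume_Ioc, sub_zero, mul_comm (lintegral _ _), ← mul_assoc,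
          ← ENNReal.ofReal_mul (by positivity), inv_mul_cancel₀ hh.ne', ENNReal.ofReal_one,
          one_mul]

/-- Joint measurability of Steklov averages depending on a parameter. -/
theorem measurable_steklov {X : Type*} [MeasurableSpace X] {f : ℝ → X → ℝ}
    (hf : Measurable fun z : ℝ × X => f z.1 z.2) {h : ℝ} (hh : 0 < h) :
    Measurable fun z : ℝ × X => steklov h (fun τ => f τ z.2) z.1 := by
  have e : (fun z : ℝ × X => steklov h (fun τ => f τ z.2) z.1) =
      fun z : ℝ × X => h⁻¹ * ∫ σ in Ioc 0 h, f (z.1 + σ) z.2 := by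
    funext z
    rw [steklov, intervalIntegral.integral_of_le hh.le]
  rw [e]
  have hm : Measurable fun q : (ℝ × X) × ℝ => f (q.1.1 + q.2) q.1.2 :=
    hf.comp ((measurable_fst.fst.add measurable_snd).prodMk measurable_fst.snd)
  exact (hm.stronglyMeasurable.integral_prod_right (ν := volume.restrict (Ioc 0 h))).measurable.const_mul _


/-- Spatial slices of Steklov averages are measurable. -/
theorem measurable_steklov_slice {X : Type*} [MeasurableSpace X] {f : ℝ → X → ℝ}
    (hf : Measurable fun z : ℝ × X => f z.1 z.2) {h : ℝ} (hh : 0 < h) (t : ℝ) :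
    Measurable fun x => steklov h (fun τ => f τ x) t :=
  (measurable_steklov hf hh).comp measurable_prodMk_left

theorem measurable_time_slice {X : Type*} [MeasurableSpace X] {f : ℝ → X → ℝ}
    (hf : Measurable fun z : ℝ × X => f z.1 z.2) (x : X) : Measurable fun τ => f τ x :=
  hf.comp measurable_prodMk_right

theorem measurable_space_slice {X : Type*} [MeasurableSpace X] {f : ℝ → X → ℝ}
    (hf : Measurable fun z : ℝ × X => f z.1 z.2) (t : ℝ) : Measurable (f t) :=
  hf.comp measurable_prodMk_left

/-- Steklov averages of bounded functions belong to `W^{1,2}(0, S; L²(Ω))`. -/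
theorem memW12L2_steklov {N : ℕ} {Ω : Set (Space N)} (hΩ : volume Ω < ⊤) {f : ℝ → Space N → ℝ}
    {h M S : ℝ} (hh : 0 < h) (hS : 0 < S) (hf : Measurable fun z : ℝ × Space N => f z.1 z.2)
    (hM : ∀ t x, |f t x| ≤ M) :
    MemW12L2 Ω S (fun t x => steklov h (fun τ => f τ x) t)
      (fun t x => h⁻¹ * (f (t + h) x - f t x)) := by
  have : IsFiniteMeasure (volume.restrict Ω) := ⟨by simpa using hΩ⟩
  have hM0 : 0 ≤ M := (abs_nonneg _).trans (hM 0 0)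
  refine ⟨⟨fun t _ => ?_, fun t₀ _ => ?_⟩, ?_, ?_, ?_⟩
  · exact MemLp.of_bound (measurable_steklov_slice hf hh t).aestronglyMeasurable M
      (Eventually.of_forall fun x => abs_steklov_le hh (fun τ => hM τ x) t)
  -- The Lipschitz bound in time is uniform in x and Ω has finite measure, so it passes to the L²
  -- norm.
  · have hb : ∀ t, eLpNorm (fun x => steklov h (fun τ => f τ x) t - steklov h (fun τ => f τ x) t₀)
        2 (volume.restrict Ω) ≤ (volume.restrict Ω) univ ^ (2 : ℝ≥0∞).toReal⁻¹ *
          ENNReal.ofReal (2 * M / h * |t - t₀|) := fun t =>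
      eLpNorm_le_of_ae_bound (Eventually.of_forall fun x =>
        abs_steklov_sub_le hh (measurable_time_slice hf x) (fun τ => hM τ x) t t₀)
    refine tendsto_of_tendsto_of_tendsto_of_le_of_le tendsto_const_nhds ?_
      (fun _ => zero_le) hb
    have h1 : Tendsto (fun t : ℝ => ENNReal.ofReal (2 * M / h * |t - t₀|)) (𝓝[Icc 0 S] t₀)
        (𝓝 0) := by
      have hc : Continuous fun t : ℝ => ENNReal.ofReal (2 * M / h * |t - t₀|) :=
        ENNReal.continuous_ofReal.comp (by fun_prop)
      have := (hc.tendsto t₀).mono_left (nhdsWithin_le_nhds (s := Icc 0 S))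
      simpa using this
    have := ENNReal.Tendsto.const_mul (a := (volume.restrict Ω) univ ^ (2 : ℝ≥0∞).toReal⁻¹) h1
      (Or.inr (ENNReal.rpow_ne_top_of_nonneg (by positivity) (measure_ne_top _ _)))
    simpa using this
  · exact MemLp.of_bound (measurable_steklov hf hh).aestronglyMeasurable M
      (Eventually.of_forall fun z => abs_steklov_le hh (fun τ => hM τ z.2) z.1)
  · have hm : Measurable fun z : ℝ × Space N => h⁻¹ * (f (z.1 + h) z.2 - f z.1 z.2) :=
      ((hf.comp ((measurable_fst.add_const h).prodMk measurable_snd)).sub hf).const_mul _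
    refine MemLp.of_bound hm.aestronglyMeasurable (h⁻¹ * (M + M))
      (Eventually.of_forall fun z => ?_)
    rw [Real.norm_eq_abs, abs_mul, abs_of_pos (inv_pos.2 hh)]
    gcongr
    exact (abs_sub _ _).trans (add_le_add (hM _ _) (hM _ _))
  · intro η hη _ hsupp
    exact Eventually.of_forall fun x =>
      integral_steklov_mul_deriv hh hS (measurable_time_slice hf x) (fun τ => hM τ x) hη hsupp

/-- The density of the Gagliardo seminorm. -/
def gagliardoDensity {N : ℕ} (s p : ℝ) (w : Space N → ℝ) (z : Space N × Space N) : ℝ :=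
  |w z.1 - w z.2| ^ p / ‖z.1 - z.2‖ ^ ((N : ℝ) + p * s)

theorem gagliardoDensity_nonneg {N : ℕ} (s p : ℝ) (w : Space N → ℝ) (z : Space N × Space N) :
    0 ≤ gagliardoDensity s p w z := by
  unfold gagliardoDensity; positivity

theorem measurable_gagliardoDensity {N : ℕ} {s p : ℝ} {f : ℝ → Space N → ℝ}
    (hf : Measurable fun z : ℝ × Space N => f z.1 z.2) :
    Measurable fun q : ℝ × (Space N × Space N) => gagliardoDensity s p (f q.1) q.2 := by
  unfold gagliardoDensity
  have h1 : Measurable fun q : ℝ × (Space N × Space N) => f q.1 q.2.1 :=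
    hf.comp (measurable_fst.prodMk measurable_snd.fst)
  have h2 : Measurable fun q : ℝ × (Space N × Space N) => f q.1 q.2.2 :=
    hf.comp (measurable_fst.prodMk measurable_snd.snd)
  have h3 : Measurable (fun q : ℝ × (Space N × Space N) => ‖q.2.1 - q.2.2‖) := by fun_prop
  exact ((h1.sub h2).norm.pow_const _).div (h3.pow_const _)

theorem lintegral_gagliardo_eq {N : ℕ} {s p : ℝ} {f : ℝ → Space N → ℝ}
    (hf : Measurable fun z : ℝ × Space N => f z.1 z.2) (μ : Measure ℝ) [SFinite μ] :
    ∫⁻ t, gagliardo N s p (f t) ∂μ = ∫⁻ q, ENNReal.ofReal (gagliardoDensity s p (f q.1) q.2)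
      ∂(μ.prod (volume : Measure (Space N × Space N))) := by
  rw [lintegral_prod _ (measurable_gagliardoDensity hf).ennreal_ofReal.aemeasurable]
  rfl

/-- Steklov averaging does not increase the integral of the Gagliardo seminorm. -/
theorem lintegral_gagliardo_steklov_le {N : ℕ} {s p : ℝ} (hp : 1 ≤ p) {f : ℝ → Space N → ℝ}
    {h M : ℝ} (hh : 0 < h) (hf : Measurable fun z : ℝ × Space N => f z.1 z.2)
    (hM : ∀ t x, |f t x| ≤ M) :
    ∫⁻ t, gagliardo N s p (fun x => steklov h (fun τ => f τ x) t) ≤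
      ∫⁻ t, gagliardo N s p (f t) := by
  rw [lintegral_gagliardo_eq (f := fun t x => steklov h (fun τ => f τ x) t)
      (measurable_steklov hf hh), lintegral_gagliardo_eq hf,
    lintegral_prod_symm' _
      (measurable_gagliardoDensity (f := fun t x => steklov h (fun τ => f τ x) t)
        (measurable_steklov hf hh)).ennreal_ofReal,
    lintegral_prod_symm' _ (measurable_gagliardoDensity hf).ennreal_ofReal]
  -- For a fixed pair z the weight is constant in time and averaging is linear, so the scalar L^p
  -- contraction applies to the difference of the two time slices.
  refine lintegral_mono fun z => ?_
  have e : ∀ a : ℝ, ENNReal.ofReal (|a| ^ p / ‖z.1 - z.2‖ ^ ((N : ℝ) + p * s)) =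
      ENNReal.ofReal ((‖z.1 - z.2‖ ^ ((N : ℝ) + p * s))⁻¹) * ENNReal.ofReal (|a| ^ p) := by
    intro a
    rw [← ENNReal.ofReal_mul (by positivity), div_eq_inv_mul]
  simp only [gagliardoDensity, e]
  rw [lintegral_const_mul' _ _ ENNReal.ofReal_ne_top, lintegral_const_mul' _ _ ENNReal.ofReal_ne_top]
  refine mul_le_mul_right ?_ _
  have h1 := measurable_time_slice hf z.1
  have h2 := measurable_time_slice hf z.2
  simp only [← steklov_sub h1 h2 (fun τ => hM τ z.1) (fun τ => hM τ z.2)]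
  exact lintegral_steklov_rpow_le (M := M + M) hh hp (h1.sub h2) fun τ =>
    (abs_sub _ _).trans (add_le_add (hM _ _) (hM _ _))

/-- Steklov averages of bounded functions with finite energy belong to
`L^p(0, S; W^{s,p}_0(Ω))`. -/
theorem memLpWsp0_steklov {N : ℕ} {s p : ℝ} (hp : 1 ≤ p) {Ω : Set (Space N)}
    (hΩm : MeasurableSet Ω) (hΩ : volume Ω < ⊤)
    {f : ℝ → Space N → ℝ} {h M S : ℝ} (hh : 0 < h)
    (hf : Measurable fun z : ℝ × Space N => f z.1 z.2) (hM : ∀ t x, |f t x| ≤ M)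
    (hf0 : ∀ t, ∀ x ∉ Ω, f t x = 0) (hG : ∫⁻ t, gagliardo N s p (f t) < ⊤) :
    MemLpWsp0 s p Ω S (fun t x => steklov h (fun τ => f τ x) t) := by
  have hM0 : 0 ≤ M := (abs_nonneg _).trans (hM 0 0)
  have hG' := (lintegral_gagliardo_steklov_le (s := s) hp hh hf hM).trans_lt hG
  have hφ := measurable_steklov hf hh
  have hφ0 : ∀ t, ∀ x ∉ Ω, steklov h (fun τ => f τ x) t = 0 := fun t x hx =>
    steklov_eq_zero hh fun τ _ _ => hf0 τ x hx
  have hgm : Measurable fun t => gagliardo N s p (fun x => steklov h (fun τ => f τ x) t) :=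
    (measurable_gagliardoDensity (f := fun t x => steklov h (fun τ => f τ x) t)
      hφ).ennreal_ofReal.lintegral_prod_right'
  have hLp : ∀ t, ∫⁻ x, ENNReal.ofReal (|steklov h (fun τ => f τ x) t| ^ p) ≤
      ENNReal.ofReal (M ^ p) * volume Ω := by
    intro t
    rw [← setLIntegral_const, ← lintegral_indicator hΩm]
    refine lintegral_mono fun x => ?_
    by_cases hx : x ∈ Ω
    · rw [indicator_of_mem hx]
      exact ENNReal.ofReal_le_ofReal (Real.rpow_le_rpow (abs_nonneg _)
        (abs_steklov_le hh (fun τ => hM τ x) t) (by linarith))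
    · rw [indicator_of_notMem hx, hφ0 t x hx, abs_zero, Real.zero_rpow (by linarith)]
      simp
  refine ⟨hφ.aestronglyMeasurable, ?_, ?_⟩
  · have hfin : ∀ᵐ t, gagliardo N s p (fun x => steklov h (fun τ => f τ x) t) < ⊤ :=
      ae_lt_top hgm hG'.ne
    filter_upwards [ae_restrict_of_ae hfin] with t ht
    refine ⟨⟨(measurable_steklov_slice hf hh t).aestronglyMeasurable, ?_⟩, ht, ?_⟩
    · rw [eLpNorm_lt_top_iff_lintegral_rpow_enorm_lt_top (by simp; linarith) ENNReal.ofReal_ne_top,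
        ENNReal.toReal_ofReal (by linarith)]
      refine lt_of_le_of_lt (le_of_eq ?_) ((hLp t).trans_lt
        (ENNReal.mul_lt_top ENNReal.ofReal_lt_top hΩ))
      refine lintegral_congr fun x => ?_
      rw [← ofReal_norm, Real.norm_eq_abs,
        ENNReal.ofReal_rpow_of_nonneg (abs_nonneg _) (by linarith)]
    · exact (ae_restrict_iff' hΩm.compl).2 (Eventually.of_forall fun x hx => hφ0 t x hx)
  · rw [lintegral_add_right _ hgm]
    refine ENNReal.add_lt_top.2 ⟨?_, (setLIntegral_le_lintegral _ _).trans_lt hG'⟩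
    refine (lintegral_mono hLp).trans_lt ?_
    rw [setLIntegral_const]
    exact ENNReal.mul_lt_top (ENNReal.mul_lt_top ENNReal.ofReal_lt_top hΩ) (by simp)

/-! ### Fatou argument for sign-changing integrands -/

/-- A Fatou lemma for functions of variable sign bounded by functions whose integrals do not
exceed the integral of their limit. -/
theorem lintegral_ofReal_le_of_tendsto {X : Type*} [MeasurableSpace X] {μ : Measure X}
    {P D A : X → ℝ} {Pn An : ℕ → X → ℝ} {C L : ℝ} {Ln : ℕ → ℝ} (hC : 0 ≤ C)
    (hPm : ∀ n, AEStronglyMeasurable (Pn n) μ) (hD : Integrable D μ) (hA : Integrable A μ)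
    (hAn : ∀ n, Integrable (An n) μ) (hD0 : 0 ≤ D) (hA0 : 0 ≤ A)
    (hP0 : 0 ≤ᵐ[μ] P)
    (hbound : ∀ n, ∀ᵐ x ∂μ, |Pn n x| ≤ C * (D x + An n x))
    (hPlim : ∀ᵐ x ∂μ, Tendsto (fun n => Pn n x) atTop (𝓝 (P x)))
    (hAlim : ∀ᵐ x ∂μ, Tendsto (fun n => An n x) atTop (𝓝 (A x)))
    (hAint : ∀ n, ∫ x, An n x ∂μ ≤ ∫ x, A x ∂μ)
    (hL : ∀ n, ∫ x, Pn n x ∂μ ≤ Ln n) (hLlim : Tendsto Ln atTop (𝓝 L)) :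
    0 ≤ L ∧ ∫⁻ x, ENNReal.ofReal (P x) ∂μ ≤ ENNReal.ofReal L := by
  have hPint : ∀ n, Integrable (Pn n) μ := fun n =>
    ((hD.add (hAn n)).const_mul C).mono' (hPm n) (hbound n)
  -- The shifted functions Pn + C (D + An) are nonnegative with integral at most Ln + X₀. Fatou
  -- applies to them, and the finite number `X₀` is cancelled at the end.
  set X₀ : ℝ := C * (∫ x, D x ∂μ + ∫ x, A x ∂μ) with hX₀
  have hX₀0 : 0 ≤ X₀ := mul_nonneg hC (add_nonneg (integral_nonneg hD0) (integral_nonneg hA0))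
  have hDAi : Integrable (fun x => C * (D x + A x)) μ := (hD.add hA).const_mul C
  have hDA : ∫⁻ x, ENNReal.ofReal (C * (D x + A x)) ∂μ = ENNReal.ofReal X₀ := by
    rw [← ofReal_integral_eq_lintegral_ofReal hDAi
      (Eventually.of_forall fun x => mul_nonneg hC (add_nonneg (hD0 x) (hA0 x))),
      integral_const_mul, integral_add hD hA]
  have hint : ∀ n, Integrable (fun x => C * (D x + An n x)) μ := fun n =>
    (hD.add (hAn n)).const_mul C
  have hint2 : ∀ n, Integrable (fun x => Pn n x + C * (D x + An n x)) μ := fun n =>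
    (hPint n).add (hint n)
  have hHn0 : ∀ n, 0 ≤ᵐ[μ] fun x => Pn n x + C * (D x + An n x) := fun n =>
    (hbound n).mono fun x hx => by
      have := neg_le_of_abs_le hx
      simp only [Pi.zero_apply]; linarith
  have hHle : ∀ n, ∫ x, (Pn n x + C * (D x + An n x)) ∂μ ≤ Ln n + X₀ := by
    intro n
    rw [integral_add (hPint n) (hint n), integral_const_mul, integral_add hD (hAn n)]
    have := mul_le_mul_of_nonneg_left (hAint n) hC
    have := hL n
    rw [hX₀]; linarith
  have hLX : 0 ≤ L + X₀ := ge_of_tendsto' (hLlim.add_const X₀) fun n =>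
    (integral_nonneg_of_ae (hHn0 n)).trans (hHle n)
  have hHn : ∀ n, ∫⁻ x, ENNReal.ofReal (Pn n x + C * (D x + An n x)) ∂μ ≤
      ENNReal.ofReal (Ln n + X₀) := by
    intro n
    rw [← ofReal_integral_eq_lintegral_ofReal (hint2 n) (hHn0 n)]
    exact ENNReal.ofReal_le_ofReal (hHle n)
  have hfatou : ∫⁻ x, ENNReal.ofReal (P x + C * (D x + A x)) ∂μ ≤
      liminf (fun n => ∫⁻ x, ENNReal.ofReal (Pn n x + C * (D x + An n x)) ∂μ) atTop := by
    refine le_trans (lintegral_mono_ae ?_) (lintegral_liminf_le' fun n =>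
      ((hPint n).add ((hD.add (hAn n)).const_mul C)).aemeasurable.ennreal_ofReal)
    filter_upwards [hPlim, hAlim] with x hx1 hx2
    refine le_of_eq (Tendsto.liminf_eq ?_).symm
    exact (ENNReal.continuous_ofReal.tendsto _).comp
      (hx1.add (((tendsto_const_nhds).add hx2).const_mul C))
  have hlim : liminf (fun n => ∫⁻ x, ENNReal.ofReal (Pn n x + C * (D x + An n x)) ∂μ) atTop ≤
      ENNReal.ofReal (L + X₀) := by
    refine (liminf_le_liminf (Eventually.of_forall hHn)).trans (le_of_eq ?_)
    exact ((ENNReal.continuous_ofReal.tendsto _).comp (hLlim.add_const X₀)).liminf_eq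
  have hsplit : ∫⁻ x, ENNReal.ofReal (P x + C * (D x + A x)) ∂μ =
      ∫⁻ x, ENNReal.ofReal (P x) ∂μ + ENNReal.ofReal X₀ := by
    rw [← hDA, ← lintegral_add_right' _ hDAi.aemeasurable.ennreal_ofReal]
    refine lintegral_congr_ae ?_
    filter_upwards [hP0] with x hx
    exact ENNReal.ofReal_add hx (mul_nonneg hC (add_nonneg (hD0 x) (hA0 x)))
  have := hsplit ▸ (hfatou.trans hlim)
  refine ⟨?_, ENNReal.le_of_add_le_add_right ENNReal.ofReal_ne_top
    (this.trans ENNReal.ofReal_add_le)⟩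
  -- This yields X₀ ≤ L + X₀. The sign of L must be recorded separately because `ENNReal.ofReal`
  -- erases negative values.
  have h0 := (ENNReal.ofReal_le_ofReal_iff hLX).1 (le_add_self.trans this)
  linarith

/-! ### Cut-off powers and the discrete time derivative -/

/-- The function `1_{(t₁, t₂]}(τ) v(τ, x)^e`. -/
def cutPow {X : Type*} (t₁ t₂ e : ℝ) (v : ℝ → X → ℝ) (τ : ℝ) (x : X) : ℝ :=
  (Ioc t₁ t₂).indicator (fun τ => v τ x ^ e) τ

theorem measurable_cutPow {X : Type*} [MeasurableSpace X] {t₁ t₂ e : ℝ} {v : ℝ → X → ℝ}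
    (hv : Measurable fun z : ℝ × X => v z.1 z.2) :
    Measurable fun z : ℝ × X => cutPow t₁ t₂ e v z.1 z.2 := by
  have : (fun z : ℝ × X => cutPow t₁ t₂ e v z.1 z.2) =
      (Prod.fst ⁻¹' Ioc t₁ t₂).indicator fun z : ℝ × X => v z.1 z.2 ^ e := by
    funext z
    simp only [cutPow, indicator, mem_preimage]
  rw [this]
  exact (hv.pow_const e).indicator (measurable_fst measurableSet_Ioc)

theorem abs_cutPow_le {X : Type*} {t₁ t₂ e M : ℝ} (he : 0 ≤ e) {v : ℝ → X → ℝ}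
    (hv0 : ∀ t x, 0 ≤ v t x) (hvM : ∀ t x, v t x ≤ M) (t : ℝ) (x : X) :
    |cutPow t₁ t₂ e v t x| ≤ M ^ e := by
  have hM : 0 ≤ M := (hv0 t x).trans (hvM t x)
  unfold cutPow
  by_cases ht : t ∈ Ioc t₁ t₂
  · rw [indicator_of_mem ht, abs_of_nonneg (Real.rpow_nonneg (hv0 t x) _)]
    exact Real.rpow_le_rpow (hv0 t x) (hvM t x) he
  · rw [indicator_of_notMem ht, abs_zero]
    positivity

/-- Powers with exponent at least one are Lipschitz on bounded intervals. -/
theorem abs_rpow_sub_rpow_le {e M a b : ℝ} (he : 1 ≤ e) (ha : 0 ≤ a) (haM : a ≤ M) (hb : 0 ≤ b)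
    (hbM : b ≤ M) : |a ^ e - b ^ e| ≤ e * M ^ (e - 1) * |a - b| := by
  have := Convex.norm_image_sub_le_of_norm_hasDerivWithin_le (f := fun x : ℝ => x ^ e)
    (f' := fun x => e * x ^ (e - 1)) (s := Icc 0 M) (C := e * M ^ (e - 1)) (x := b) (y := a)
    (fun x _ => (Real.hasDerivAt_rpow_const (Or.inr he)).hasDerivWithinAt)
    (fun x hx => by
      rw [Real.norm_eq_abs, abs_of_nonneg (mul_nonneg (by linarith) (Real.rpow_nonneg hx.1 _))]
      exact mul_le_mul_of_nonneg_left (Real.rpow_le_rpow hx.1 hx.2 (by linarith)) (by linarith))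
    (convex_Icc 0 M) ⟨hb, hbM⟩ ⟨ha, haM⟩
  simpa using this

/-- An exponent e ≥ 1 makes the power Lipschitz on [0, M], so the energy survives. With e = r - 1
this is where r ≥ 2 enters. -/
theorem gagliardo_cutPow_le {N : ℕ} {s p t₁ t₂ e M : ℝ} (hp : 0 < p) (he : 1 ≤ e)
    {v : ℝ → Space N → ℝ} (hv0 : ∀ t x, 0 ≤ v t x) (hvM : ∀ t x, v t x ≤ M) (t : ℝ) :
    gagliardo N s p (cutPow t₁ t₂ e v t) ≤
      ENNReal.ofReal ((e * M ^ (e - 1)) ^ p) * (Ioc t₁ t₂).indicator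
        (fun t => gagliardo N s p (v t)) t := by
  have hM : 0 ≤ M := (hv0 t 0).trans (hvM t 0)
  by_cases ht : t ∈ Ioc t₁ t₂
  · rw [indicator_of_mem ht]
    unfold gagliardo
    rw [← lintegral_const_mul' _ _ ENNReal.ofReal_ne_top]
    refine lintegral_mono fun z => ?_
    rw [← ENNReal.ofReal_mul (by positivity)]
    refine ENNReal.ofReal_le_ofReal ?_
    rw [← mul_div_assoc, ← Real.mul_rpow (by positivity) (abs_nonneg _)]
    gcongr
    simp only [cutPow, indicator_of_mem ht]
    exact abs_rpow_sub_rpow_le he (hv0 _ _) (hvM _ _) (hv0 _ _) (hvM _ _)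
  · have : gagliardo N s p (cutPow t₁ t₂ e v t) ≤ 0 := by
      unfold gagliardo
      simp only [cutPow, indicator_of_notMem ht]
      simp [Real.zero_rpow hp.ne']
    exact this.trans zero_le


/-- Young's inequality in the form `a b^{r-1} ≤ a^r / r + (1 - 1/r) b^r`. -/
theorem mul_rpow_sub_one_le {r a b : ℝ} (hr : 1 < r) (ha : 0 ≤ a) (hb : 0 ≤ b) :
    a * b ^ (r - 1) ≤ r⁻¹ * a ^ r + (1 - r⁻¹) * b ^ r := by
  have hr0 : 0 < r := by linarith
  have hr' : r - 1 ≠ 0 := by linarith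
  have hconj : r.HolderConjugate (r / (r - 1)) := Real.HolderConjugate.conjExponent hr
  have := Real.young_inequality_of_nonneg ha (Real.rpow_nonneg hb (r - 1)) hconj
  rw [← Real.rpow_mul hb, mul_div_cancel₀ _ hr'] at this
  refine this.trans (le_of_eq ?_)
  field_simp

theorem rpow_bounded {g : ℝ → ℝ} {M e : ℝ} (he : 0 ≤ e) (hg0 : ∀ t, 0 ≤ g t) (hgM : ∀ t, g t ≤ M)
    (t : ℝ) : |g t ^ e| ≤ M ^ e := by
  rw [abs_of_nonneg (Real.rpow_nonneg (hg0 t) _)]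
  exact Real.rpow_le_rpow (hg0 t) (hgM t) he

/-- The discrete time derivative tested with a power, for a scalar function. -/
theorem integral_mul_diff_quotient_le {g : ℝ → ℝ} {r h t₁ t₂ S M : ℝ} (hr : 1 < r) (hh : 0 < h)
    (h₁ : h < t₁) (h₁₂ : t₁ < t₂) (h₂ : t₂ < S) (hg : Measurable g) (hg0 : ∀ t, 0 ≤ g t)
    (hgM : ∀ t, g t ≤ M) :
    ∫ τ in Ioo 0 S, g τ * (h⁻¹ * ((Ioc t₁ t₂).indicator (fun τ => g τ ^ (r - 1)) (τ + h) -
        (Ioc t₁ t₂).indicator (fun τ => g τ ^ (r - 1)) τ)) ≤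
      (r * h)⁻¹ * ((∫ τ in (t₁ - h)..t₁, g τ ^ r) - ∫ τ in (t₂ - h)..t₂, g τ ^ r) := by
  have hr0 : 0 < r := by linarith
  set F : ℝ → ℝ := (Ioc t₁ t₂).indicator (fun τ => g τ ^ (r - 1)) with hF
  have hFm : Measurable F := (hg.pow_const _).indicator measurableSet_Ioc
  have hM : 0 ≤ M := (hg0 0).trans (hgM 0)
  have hFb : ∀ t, |F t| ≤ M ^ (r - 1) := by
    intro t
    by_cases ht : t ∈ Ioc t₁ t₂
    · rw [hF, indicator_of_mem ht]; exact rpow_bounded (by linarith) hg0 hgM t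
    · rw [hF, indicator_of_notMem ht, abs_zero]; positivity
  have hgr : ∀ a b, IntervalIntegrable (fun τ => g τ ^ r) volume a b := fun a b =>
    intervalIntegrable_of_bounded (hg.pow_const r) (rpow_bounded hr0.le hg0 hgM) a b
  have hgrs : IntervalIntegrable (fun τ => g (τ - h) ^ r) volume t₁ t₂ :=
    intervalIntegrable_of_bounded (M := M ^ r) ((hg.comp (measurable_id.sub_const h)).pow_const r)
      (rpow_bounded (g := fun τ => g (τ - h)) hr0.le (fun _ => hg0 _) (fun _ => hgM _)) t₁ t₂
  have hbd : ∀ {k : ℝ → ℝ}, Measurable k → (∀ t, |k t| ≤ M ^ (r - 1)) →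
      ∀ {l : ℝ → ℝ}, Measurable l → (∀ t, 0 ≤ l t) → (∀ t, l t ≤ M) → ∀ t, |l t * k t| ≤
        M * M ^ (r - 1) := by
    intro k _ hkb l _ hl0 hlM t
    rw [abs_mul, abs_of_nonneg (hl0 t)]
    exact mul_le_mul (hlM t) (hkb t) (abs_nonneg _) hM
  have hI1 : IntegrableOn (fun τ => g τ * F (τ + h)) (Ioo 0 S) := by
    refine ((intervalIntegrable_iff_integrableOn_Ioo_of_le (by linarith)).1 ?_)
    exact intervalIntegrable_of_bounded (hg.mul (hFm.comp (measurable_add_const h)))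
      (hbd (hFm.comp (measurable_add_const h)) (fun t => hFb _) hg hg0 hgM) 0 S
  have hI2 : IntegrableOn (fun τ => g τ * F τ) (Ioo 0 S) := by
    refine ((intervalIntegrable_iff_integrableOn_Ioo_of_le (by linarith)).1 ?_)
    exact intervalIntegrable_of_bounded (hg.mul hFm) (hbd hFm hFb hg hg0 hgM) 0 S
  have hF0 : ∀ τ, τ ∉ Ioc t₁ t₂ → F τ = 0 := fun τ hτ => indicator_of_notMem hτ _
  -- Time is shifted by h. The support of τ ↦ F(τ + h) lies in (t₁ - h, t₂ - h], which `h₁` and `h₂`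
  -- keep inside (0, S), so the domain plays no role.
  have e1 : ∫ τ in Ioo 0 S, g τ * F (τ + h) = ∫ τ in t₁..t₂, g (τ - h) * g τ ^ (r - 1) := by
    rw [setIntegral_eq_integral_of_forall_compl_eq_zero, intervalIntegral.integral_of_le h₁₂.le,
      ← integral_indicator measurableSet_Ioc,
      ← integral_add_right_eq_self (μ := volume)
        ((Ioc t₁ t₂).indicator fun τ => g (τ - h) * g τ ^ (r - 1)) h]
    · congr 1; funext τ
      by_cases hτ : τ + h ∈ Ioc t₁ t₂
      · rw [indicator_of_mem hτ, hF, indicator_of_mem hτ, add_sub_cancel_right]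
      · rw [indicator_of_notMem hτ, hF0 _ hτ, mul_zero]
    · intro τ hτ
      rw [hF0, mul_zero]
      intro hm
      exact hτ ⟨by linarith [hm.1], by linarith [hm.2]⟩
  have e2 : ∫ τ in Ioo 0 S, g τ * F τ = ∫ τ in t₁..t₂, g τ ^ r := by
    rw [setIntegral_eq_integral_of_forall_compl_eq_zero, intervalIntegral.integral_of_le h₁₂.le,
      ← integral_indicator measurableSet_Ioc]
    · congr 1; funext τ
      by_cases hτ : τ ∈ Ioc t₁ t₂
      · rw [indicator_of_mem hτ, hF, indicator_of_mem hτ]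
        rw [← Real.rpow_one_add' (hg0 τ) (by linarith)]
        congr 1; ring
      · rw [indicator_of_notMem hτ, hF0 _ hτ, mul_zero]
    · intro τ hτ
      rw [hF0, mul_zero]
      intro hm
      exact hτ ⟨by linarith [hm.1], by linarith [hm.2]⟩
  -- The weights r⁻¹ and 1 - r⁻¹ are such that, after subtracting ∫ g^r, only r⁻¹ times the
  -- difference of two shifted integrals remains; their overlap cancels in `hsplit`.
  have hyoung : ∫ τ in t₁..t₂, g (τ - h) * g τ ^ (r - 1) ≤
      r⁻¹ * (∫ τ in t₁..t₂, g (τ - h) ^ r) + (1 - r⁻¹) * ∫ τ in t₁..t₂, g τ ^ r := by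
    rw [← intervalIntegral.integral_const_mul, ← intervalIntegral.integral_const_mul,
      ← intervalIntegral.integral_add (hgrs.const_mul _) ((hgr _ _).const_mul _)]
    refine intervalIntegral.integral_mono_on h₁₂.le ?_
      ((hgrs.const_mul _).add ((hgr _ _).const_mul _))
      (fun τ _ => mul_rpow_sub_one_le hr (hg0 _) (hg0 _))
    exact intervalIntegrable_of_bounded
      ((hg.comp (measurable_id.sub_const h)).mul (hg.pow_const _))
      (hbd (hg.pow_const _) (rpow_bounded (by linarith) hg0 hgM)
        (l := fun τ => g (τ - h)) (hg.comp (measurable_id.sub_const h)) (fun _ => hg0 _)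
        (fun _ => hgM _)) _ _
  have hshift : ∫ τ in t₁..t₂, g (τ - h) ^ r = ∫ τ in (t₁ - h)..(t₂ - h), g τ ^ r :=
    intervalIntegral.integral_comp_sub_right (fun τ => g τ ^ r) h
  have hsplit : (∫ τ in (t₁ - h)..(t₂ - h), g τ ^ r) - ∫ τ in t₁..t₂, g τ ^ r =
      (∫ τ in (t₁ - h)..t₁, g τ ^ r) - ∫ τ in (t₂ - h)..t₂, g τ ^ r :=
    intervalIntegral.integral_interval_sub_interval_comm (hgr _ _) (hgr _ _) (hgr _ _)
  calc _ = h⁻¹ * ((∫ τ in Ioo 0 S, g τ * F (τ + h)) - ∫ τ in Ioo 0 S, g τ * F τ) := by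
        rw [← integral_sub hI1 hI2, ← integral_const_mul]
        congr 1; funext τ; ring
    _ ≤ h⁻¹ * (r⁻¹ * ((∫ τ in (t₁ - h)..(t₂ - h), g τ ^ r) - ∫ τ in t₁..t₂, g τ ^ r)) := by
        refine mul_le_mul_of_nonneg_left ?_ (by positivity)
        rw [e1, e2, ← hshift]
        linarith
    _ = _ := by rw [hsplit, mul_inv]; ring

/-- The discrete time derivative tested with a power, integrated over space. -/
theorem integral_integral_mul_diff_quotient_le {X : Type*} [MeasurableSpace X] {ν : Measure X}
    [Nonempty X] [IsFiniteMeasure ν] {v : ℝ → X → ℝ} {r h t₁ t₂ S M : ℝ} (hr : 1 < r) (hh : 0 < h)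
    (h₁ : h < t₁) (h₁₂ : t₁ < t₂) (h₂ : t₂ < S) (hv : Measurable fun z : ℝ × X => v z.1 z.2)
    (hv0 : ∀ t x, 0 ≤ v t x) (hvM : ∀ t x, v t x ≤ M) :
    ∫ τ in Ioo 0 S, ∫ x, v τ x * (h⁻¹ * (cutPow t₁ t₂ (r - 1) v (τ + h) x -
        cutPow t₁ t₂ (r - 1) v τ x)) ∂ν ≤
      (r * h)⁻¹ * ((∫ τ in (t₁ - h)..t₁, ∫ x, v τ x ^ r ∂ν) -
        ∫ τ in (t₂ - h)..t₂, ∫ x, v τ x ^ r ∂ν) := by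
  obtain ⟨x₀⟩ := ‹Nonempty X›
  have hM : 0 ≤ M := (hv0 0 x₀).trans (hvM 0 x₀)
  have hcm := measurable_cutPow (t₁ := t₁) (t₂ := t₂) (e := r - 1) hv
  have hcb := abs_cutPow_le (t₁ := t₁) (t₂ := t₂) (by linarith : 0 ≤ r - 1) hv0 hvM
  have hint : Integrable (Function.uncurry fun (τ : ℝ) (x : X) =>
      v τ x * (h⁻¹ * (cutPow t₁ t₂ (r - 1) v (τ + h) x - cutPow t₁ t₂ (r - 1) v τ x)))
      ((volume.restrict (Ioo 0 S)).prod ν) := by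
    have hm : Measurable (Function.uncurry fun (τ : ℝ) (x : X) =>
      v τ x * (h⁻¹ * (cutPow t₁ t₂ (r - 1) v (τ + h) x - cutPow t₁ t₂ (r - 1) v τ x))) :=
      hv.mul (((hcm.comp ((measurable_fst.add_const h).prodMk measurable_snd)).sub hcm).const_mul _)
    refine Integrable.of_bound hm.aestronglyMeasurable
      (M * (h⁻¹ * (M ^ (r - 1) + M ^ (r - 1)))) (Eventually.of_forall fun z => ?_)
    simp only [Function.uncurry, Real.norm_eq_abs]
    rw [abs_mul, abs_of_nonneg (hv0 _ _), abs_mul, abs_of_pos (inv_pos.2 hh)]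
    gcongr
    · exact hvM _ _
    · exact (abs_sub _ _).trans (add_le_add (hcb _ _) (hcb _ _))
  have hrm : Measurable fun z : ℝ × X => v z.1 z.2 ^ r := hv.pow_const r
  have hIoc : ∀ a b : ℝ, Integrable (Function.uncurry fun (τ : ℝ) (x : X) => v τ x ^ r)
      ((volume.restrict (Ioc a b)).prod ν) := fun a b =>
    Integrable.of_bound hrm.aestronglyMeasurable (M ^ r) (Eventually.of_forall fun z => by
      simp only [Function.uncurry, Real.norm_eq_abs]
      rw [abs_of_nonneg (Real.rpow_nonneg (hv0 _ _) _)]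
      exact Real.rpow_le_rpow (hv0 _ _) (hvM _ _) (by linarith))
  have hswap : ∀ a : ℝ, ∫ τ in (a - h)..a, ∫ x, v τ x ^ r ∂ν =
      ∫ x, (∫ τ in (a - h)..a, v τ x ^ r) ∂ν := by
    intro a
    simp only [intervalIntegral.integral_of_le (sub_le_self a hh.le)]
    exact integral_integral_swap (hIoc _ _)
  have hI : ∀ a : ℝ, Integrable (fun x => ∫ τ in (a - h)..a, v τ x ^ r) ν := by
    intro a
    simp only [intervalIntegral.integral_of_le (sub_le_self a hh.le)]
    exact (hIoc _ _).integral_prod_right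
  rw [integral_integral_swap hint, hswap, hswap, ← integral_sub (hI _) (hI _),
    ← integral_const_mul]
  refine integral_mono hint.integral_prod_right (((hI _).sub (hI _)).const_mul _) fun x => ?_
  exact integral_mul_diff_quotient_le hr hh h₁ h₁₂ h₂ (measurable_time_slice hv x)
    (fun t => hv0 t x) (fun t => hvM t x)

/-- Left averages of a continuous function converge to its value. -/
theorem tendsto_left_average {Y : ℝ → ℝ} {S t : ℝ} (hY : ContinuousOn Y (Icc 0 S)) (h0 : 0 < t)
    (hS : t < S) {h : ℕ → ℝ} (hpos : ∀ n, 0 < h n) (hlt : ∀ n, h n < t)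
    (hlim : Tendsto h atTop (𝓝 0)) :
    Tendsto (fun n => (h n)⁻¹ * ∫ τ in (t - h n)..t, Y τ) atTop (𝓝 (Y t)) := by
  have hnhds : Icc 0 S ∈ 𝓝 t := Icc_mem_nhds h0 hS
  have hint : ∀ a ∈ Icc 0 S, IntervalIntegrable Y volume 0 a := fun a ha =>
    (hY.mono (Icc_subset_Icc_right ha.2)).intervalIntegrable_of_Icc ha.1
  have hd : HasDerivAt (fun x => ∫ τ in (0 : ℝ)..x, Y τ) (Y t) t := by
    refine intervalIntegral.integral_hasDerivAt_right (hint t ⟨h0.le, hS.le⟩) ?_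
      (hY.continuousAt hnhds)
    exact ContinuousOn.stronglyMeasurableAtFilter_nhdsWithin hY measurableSet_Icc t |>.filter_mono
        (by rw [nhdsWithin_eq_nhds.2 hnhds])
  have hneg : Tendsto (fun n => -h n) atTop (𝓝[≠] 0) := by
    refine tendsto_nhdsWithin_iff.2 ⟨by simpa using hlim.neg, Eventually.of_forall fun n => ?_⟩
    simpa using (hpos n).ne'
  refine (hd.tendsto_slope_zero.comp hneg).congr fun n => ?_
  have e := intervalIntegral.integral_interval_sub_left (hint t ⟨h0.le, hS.le⟩)
    (hint (t - h n) ⟨by linarith [hlt n], by linarith [hpos n]⟩)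
  simp only [Function.comp, smul_eq_mul, ← sub_eq_add_neg, ← e]
  rw [inv_neg]; ring


/-! ### The energy inequality -/

/-- Lebesgue differentiation works for each z at almost every time; measurability of the convergence
set allows the two quantifiers to be exchanged. -/
theorem ae_tendsto_steklov_prod {Z : Type*} [MeasurableSpace Z] {ν : Measure Z} [SFinite ν]
    {g : ℝ → Z → ℝ} {M : ℝ} (hg : Measurable fun q : ℝ × Z => g q.1 q.2)
    (hM : ∀ t z, |g t z| ≤ M) {h : ℕ → ℝ} (hpos : ∀ n, 0 < h n) (hlim : Tendsto h atTop (𝓝 0))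
    (A : Set ℝ) :
    ∀ᵐ q ∂((volume.restrict A).prod ν),
      Tendsto (fun n => steklov (h n) (fun τ => g τ q.2) q.1) atTop (𝓝 (g q.1 q.2)) := by
  have hms : MeasurableSet {q : ℝ × Z |
      Tendsto (fun n => steklov (h n) (fun τ => g τ q.2) q.1) atTop (𝓝 (g q.1 q.2))} :=
    measurableSet_tendsto_fun (fun n => measurable_steklov hg (hpos n)) hg
  rw [Measure.ae_prod_iff_ae_ae hms, Measure.ae_ae_comm hms]
  refine Eventually.of_forall fun z => ae_restrict_of_ae ?_
  have hlim' : Tendsto h atTop (𝓝[>] 0) :=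
    tendsto_nhdsWithin_iff.2 ⟨hlim, Eventually.of_forall hpos⟩
  filter_upwards [ae_tendsto_steklov (measurable_time_slice hg z) (fun t => hM t z)] with t ht
  exact ht.comp hlim'

/-- Bound of the integrand of the energy form. -/
theorem abs_energy_integrand_le {p a b K m C₁ C₂ : ℝ} (hp : 1 < p) (hC₁ : 0 < C₁) (hm : 0 ≤ m)
    (h1 : C₁ ≤ K * m) (h2 : K * m ≤ C₂) :
    |(|a| ^ (p - 2) * a * b * K)| ≤ C₂ * (|a| ^ p / m + |b| ^ p / m) := by
  have hm' : 0 < m := by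
    rcases hm.eq_or_lt with h | h
    · rw [← h] at h1; linarith
    · exact h
  have hK : 0 < K := pos_of_mul_pos_left (hC₁.trans_le h1) hm
  have hKle : K ≤ C₂ / m := by rwa [le_div_iff₀ hm']
  -- Both factors are bounded by the larger of |a| and |b|, which avoids Young's inequality.
  have hab : |a| ^ (p - 2) * |a| * |b| ≤ |a| ^ p + |b| ^ p := by
    have e : |a| ^ (p - 2) * |a| = |a| ^ (p - 1) := by
      rw [← Real.rpow_add_one' (abs_nonneg a) (by linarith)]
      congr 1; ring
    rw [e]
    have e2 : ∀ c : ℝ, 0 ≤ c → c ^ (p - 1) * c = c ^ p := fun c hc => by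
      rw [← Real.rpow_add_one' hc (by linarith)]
      congr 1; ring
    rcases le_total |a| |b| with h | h
    · calc |a| ^ (p - 1) * |b| ≤ |b| ^ (p - 1) * |b| := by
            gcongr
        _ = |b| ^ p := e2 _ (abs_nonneg b)
        _ ≤ _ := le_add_of_nonneg_left (by positivity)
    · calc |a| ^ (p - 1) * |b| ≤ |a| ^ (p - 1) * |a| := by gcongr
        _ = |a| ^ p := e2 _ (abs_nonneg a)
        _ ≤ _ := le_add_of_nonneg_right (by positivity)
  rw [abs_mul, abs_mul, abs_mul, abs_of_pos hK, abs_of_nonneg (by positivity : 0 ≤ |a| ^ (p - 2))]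
  calc |a| ^ (p - 2) * |a| * |b| * K ≤ (|a| ^ p + |b| ^ p) * (C₂ / m) := by gcongr
    _ = _ := by ring

theorem integrable_of_lintegral_ofReal_lt_top {X : Type*} [MeasurableSpace X] {μ : Measure X}
    {f : X → ℝ} (hf : Measurable f) (h0 : ∀ x, 0 ≤ f x)
    (hfin : ∫⁻ x, ENNReal.ofReal (f x) ∂μ < ⊤) : Integrable f μ :=
  ⟨hf.aestronglyMeasurable,
    (hasFiniteIntegral_iff_ofReal (Eventually.of_forall h0)).2 hfin⟩

/-- The energy inequality obtained by testing the equation with `v^{r-1}`. -/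
theorem energy_inequality {N : ℕ} {s p C₁ C₂ S M r : ℝ} (hp : 1 < p) (hr : 2 ≤ r)
    (hC₁ : 0 < C₁) (hC : C₁ ≤ C₂) {Ω : Set (Space N)} (hΩm : MeasurableSet Ω)
    (hΩ : volume Ω < ⊤)
    {K : Space N → Space N → ℝ → ℝ}
    (hK : AEStronglyMeasurable (fun q : ℝ × (Space N × Space N) => K q.2.1 q.2.2 q.1)
      ((volume.restrict (Ioo 0 S)).prod volume))
    (hKb : ∀ᵐ q : ℝ × (Space N × Space N) ∂((volume.restrict (Ioo 0 S)).prod volume),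
      C₁ ≤ K q.2.1 q.2.2 q.1 * ‖q.2.1 - q.2.2‖ ^ ((N : ℝ) + p * s) ∧
        K q.2.1 q.2.2 q.1 * ‖q.2.1 - q.2.2‖ ^ ((N : ℝ) + p * s) ≤ C₂)
    {v : ℝ → Space N → ℝ} (hv : Measurable fun z : ℝ × Space N => v z.1 z.2)
    (hv0 : ∀ t x, 0 ≤ v t x) (hvM : ∀ t x, v t x ≤ M) (hvΩ : ∀ t, ∀ x ∉ Ω, v t x = 0)
    (hG : ∫⁻ t in Ioo 0 S, gagliardo N s p (v t) < ⊤)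
    (hweak : ∀ φ φ' : ℝ → Space N → ℝ, MemW12L2 Ω S φ φ' → MemLpWsp0 s p Ω S φ →
      (∀ x, φ 0 x = 0) → (∀ x, φ S x = 0) →
      ∫ τ in Ioo 0 S, energyForm p (fun x y => K x y τ) (v τ) (φ τ) =
        ∫ τ in Ioo 0 S, ∫ x in Ω, v τ x * φ' τ x)
    {Y : ℝ → ℝ} (hY : ContinuousOn Y (Icc 0 S))
    (hYv : ∀ᵐ τ ∂(volume.restrict (Ioo 0 S)), ∫ x in Ω, v τ x ^ r = Y τ)
    {t₁ t₂ : ℝ} (h₁ : 0 < t₁) (h₁₂ : t₁ < t₂) (h₂ : t₂ < S) :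
    0 ≤ r⁻¹ * (Y t₁ - Y t₂) ∧
    ENNReal.ofReal C₁ * ∫⁻ τ in Ioc t₁ t₂, ∫⁻ z : Space N × Space N,
      ENNReal.ofReal (powerDensity s p r (v τ) z.1 z.2) ≤ ENNReal.ofReal (r⁻¹ * (Y t₁ - Y t₂)) := by
  have : IsFiniteMeasure (volume.restrict Ω) := ⟨by simpa using hΩ⟩
  have hS : 0 < S := by linarith
  have hr1 : 0 ≤ r - 1 := by linarith
  set μ : Measure (ℝ × (Space N × Space N)) := (volume.restrict (Ioo 0 S)).prod volume with hμ
  set f : ℝ → Space N → ℝ := cutPow t₁ t₂ (r - 1) v with hf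
  have hfm : Measurable fun z : ℝ × Space N => f z.1 z.2 := measurable_cutPow hv
  have hfM : ∀ t x, |f t x| ≤ M ^ (r - 1) := abs_cutPow_le hr1 hv0 hvM
  have hf0 : ∀ t, ∀ x ∉ Ω, f t x = 0 := by
    intro t x hx
    by_cases ht : t ∈ Ioc t₁ t₂
    · simp only [hf, cutPow, indicator_of_mem ht, hvΩ t x hx]
      exact Real.zero_rpow (by linarith)
    · simp only [hf, cutPow, indicator_of_notMem ht]
  have hft : ∀ t, t ∉ Ioc t₁ t₂ → ∀ x, f t x = 0 := fun t ht x => by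
    simp only [hf, cutPow, indicator_of_notMem ht]
  have hsub : Ioc t₁ t₂ ⊆ Ioo 0 S := fun t ht => ⟨h₁.trans ht.1, ht.2.trans_lt h₂⟩
  have hGf : ∫⁻ t, gagliardo N s p (f t) < ⊤ := by
    calc ∫⁻ t, gagliardo N s p (f t) ≤ ∫⁻ t, ENNReal.ofReal (((r - 1) * M ^ (r - 1 - 1)) ^ p) *
          (Ioc t₁ t₂).indicator (fun t => gagliardo N s p (v t)) t :=
          lintegral_mono fun t => gagliardo_cutPow_le (by linarith) (by linarith) hv0 hvM t
      _ = ENNReal.ofReal (((r - 1) * M ^ (r - 1 - 1)) ^ p) *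
          ∫⁻ t in Ioc t₁ t₂, gagliardo N s p (v t) := by
          rw [lintegral_const_mul' _ _ ENNReal.ofReal_ne_top, lintegral_indicator measurableSet_Ioc]
      _ < ⊤ := ENNReal.mul_lt_top ENNReal.ofReal_lt_top
          ((lintegral_mono_set hsub).trans_lt hG)
  have hGf' : ∫⁻ t in Ioo 0 S, gagliardo N s p (f t) = ∫⁻ t, gagliardo N s p (f t) := by
    rw [← lintegral_indicator measurableSet_Ioo]
    congr 1; funext t
    by_cases ht : t ∈ Ioo 0 S
    · rw [indicator_of_mem ht]
    · rw [indicator_of_notMem ht]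
      have : ∀ x, f t x = 0 := hft t fun h => ht (hsub h)
      simp [gagliardo, this, Real.zero_rpow (by linarith : p ≠ 0)]
  -- The shift n + 2 gives 0 < h n < t₁ for every n, so the averages vanish at time 0, before the
  -- window opens; since t₂ < S they also vanish at time S.
  set h : ℕ → ℝ := fun n => t₁ / (n + 2) with hh
  have hpos : ∀ n, 0 < h n := fun n => by simp only [hh]; positivity
  have hlt : ∀ n, h n < t₁ := fun n => by
    simp only [hh]
    refine div_lt_self h₁ ?_
    have : (0 : ℝ) ≤ n := by positivity
    linarith
  have hlim : Tendsto h atTop (𝓝 0) :=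
    tendsto_const_nhds.div_atTop (tendsto_atTop_add_const_right _ _ tendsto_natCast_atTop_atTop)
  set φ : ℕ → ℝ → Space N → ℝ := fun n t x => steklov (h n) (fun τ => f τ x) t with hφ
  have hφm : ∀ n, Measurable fun z : ℝ × Space N => φ n z.1 z.2 := fun n =>
    measurable_steklov hfm (hpos n)
  have hφW := fun n => memW12L2_steklov (S := S) hΩ (hpos n) hS hfm hfM
  have hφL := fun n => memLpWsp0_steklov (S := S) (s := s) hp.le hΩm hΩ (hpos n) hfm hfM hf0 hGf
  have hφ0 : ∀ n x, φ n 0 x = 0 := fun n x => steklov_eq_zero (hpos n) fun τ h0 hτ =>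
    hft τ (fun hm => by linarith [hm.1, hlt n]) x
  have hφS : ∀ n x, φ n S x = 0 := fun n x => steklov_eq_zero (hpos n) fun τ h0 hτ =>
    hft τ (fun hm => by linarith [hm.2]) x
  have h1m : ∀ {g : ℝ → Space N → ℝ}, Measurable (fun z : ℝ × Space N => g z.1 z.2) →
      Measurable fun q : ℝ × (Space N × Space N) => g q.1 q.2.1 := fun hg =>
    hg.comp (measurable_fst.prodMk measurable_snd.fst)
  have h2m : ∀ {g : ℝ → Space N → ℝ}, Measurable (fun z : ℝ × Space N => g z.1 z.2) →
      Measurable fun q : ℝ × (Space N × Space N) => g q.1 q.2.2 := fun hg =>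
    hg.comp (measurable_fst.prodMk measurable_snd.snd)
  set E : (ℝ → Space N → ℝ) → ℝ × (Space N × Space N) → ℝ := fun g q =>
    |v q.1 q.2.1 - v q.1 q.2.2| ^ (p - 2) * (v q.1 q.2.1 - v q.1 q.2.2) *
      (g q.1 q.2.1 - g q.1 q.2.2) * K q.2.1 q.2.2 q.1 with hE
  have hEm : ∀ {g : ℝ → Space N → ℝ}, Measurable (fun z : ℝ × Space N => g z.1 z.2) →
      AEStronglyMeasurable (E g) μ := by
    intro g hg
    have hm : Measurable fun q : ℝ × (Space N × Space N) =>
        |v q.1 q.2.1 - v q.1 q.2.2| ^ (p - 2) * (v q.1 q.2.1 - v q.1 q.2.2) *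
          (g q.1 q.2.1 - g q.1 q.2.2) :=
      ((((h1m hv).sub (h2m hv)).norm.pow_const _).mul ((h1m hv).sub (h2m hv))).mul
        ((h1m hg).sub (h2m hg))
    exact hm.aestronglyMeasurable.mul hK
  set G : (ℝ → Space N → ℝ) → ℝ × (Space N × Space N) → ℝ := fun g q =>
    gagliardoDensity s p (g q.1) q.2 with hGdef
  have hG0 : ∀ g q, 0 ≤ G g q := fun g q => gagliardoDensity_nonneg s p _ _
  have hGint : ∀ {g : ℝ → Space N → ℝ}, Measurable (fun z : ℝ × Space N => g z.1 z.2) →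
      ∫⁻ t in Ioo 0 S, gagliardo N s p (g t) < ⊤ → Integrable (G g) μ := by
    intro g hg hfin
    refine integrable_of_lintegral_ofReal_lt_top (measurable_gagliardoDensity hg) (hG0 g) ?_
    rwa [lintegral_gagliardo_eq hg] at hfin
  have hGφle : ∀ n, ∫⁻ t in Ioo 0 S, gagliardo N s p (φ n t) ≤
      ∫⁻ t in Ioo 0 S, gagliardo N s p (f t) := fun n => by
    rw [hGf']
    exact (setLIntegral_le_lintegral _ _).trans
      (lintegral_gagliardo_steklov_le hp.le (hpos n) hfm hfM)
  have hGf2 : ∫⁻ t in Ioo 0 S, gagliardo N s p (f t) < ⊤ := hGf' ▸ hGf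
  have hGφint : ∀ n, Integrable (G (φ n)) μ := fun n =>
    hGint (hφm n) ((hGφle n).trans_lt hGf2)
  have hbound : ∀ n, ∀ᵐ q ∂μ, |E (φ n) q| ≤ C₂ * (G v q + G (φ n) q) := fun n => by
    filter_upwards [hKb] with q hq
    exact abs_energy_integrand_le hp hC₁ (by positivity) hq.1 hq.2
  have hEint : ∀ n, Integrable (E (φ n)) μ := fun n =>
    (((hGint hv hG).add (hGφint n)).const_mul C₂).mono' (hEm (hφm n)) (hbound n)
  have hconv : ∀ᵐ q ∂μ, Tendsto (fun n => φ n q.1 q.2.1 - φ n q.1 q.2.2) atTop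
      (𝓝 (f q.1 q.2.1 - f q.1 q.2.2)) := by
    have := ae_tendsto_steklov_prod (ν := (volume : Measure (Space N × Space N)))
      (g := fun t z => f t z.1 - f t z.2) (M := M ^ (r - 1) + M ^ (r - 1))
      ((h1m hfm).sub (h2m hfm))
      (fun t z => (abs_sub _ _).trans (add_le_add (hfM _ _) (hfM _ _))) hpos hlim (Ioo 0 S)
    filter_upwards [this] with q hq
    refine hq.congr fun n => ?_
    exact steklov_sub (measurable_time_slice hfm q.2.1) (measurable_time_slice hfm q.2.2)
      (fun τ => hfM τ _) (fun τ => hfM τ _) _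
  set V : ℝ → ℝ := fun τ => ∫ x in Ω, v τ x ^ r with hV
  -- V agrees with Y only almost everywhere, which is enough inside averages; the limit h → 0 is
  -- then taken with the continuous Y.
  have hVY : ∀ a, t₁ ≤ a → a ≤ t₂ → ∀ n, ∫ τ in (a - h n)..a, V τ = ∫ τ in (a - h n)..a, Y τ := by
    intro a ha1 ha2 n
    refine intervalIntegral.integral_congr_ae ?_
    filter_upwards [(ae_restrict_iff' measurableSet_Ioo).1 hYv] with τ hτ hm
    rw [uIoc_of_le (by linarith [hpos n])] at hm
    exact hτ ⟨by linarith [hm.1, hlt n], by linarith [hm.2]⟩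
  set Ln : ℕ → ℝ := fun n => (r * h n)⁻¹ *
    ((∫ τ in (t₁ - h n)..t₁, Y τ) - ∫ τ in (t₂ - h n)..t₂, Y τ) with hLn
  have hL : ∀ n, ∫ q, E (φ n) q ∂μ ≤ Ln n := by
    intro n
    rw [integral_prod _ (hEint n)]
    have hw := hweak (φ n) _ (hφW n) (hφL n) (hφ0 n) (hφS n)
    calc _ = ∫ τ in Ioo 0 S, energyForm p (fun x y => K x y τ) (v τ) (φ n τ) := rfl
      _ ≤ _ := by
        rw [hw, hLn]
        simp only
        rw [← hVY t₁ le_rfl h₁₂.le, ← hVY t₂ h₁₂.le le_rfl]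
        exact integral_integral_mul_diff_quotient_le (by linarith) (hpos n) (hlt n) h₁₂ h₂ hv
          hv0 hvM
  have hLlim : Tendsto Ln atTop (𝓝 (r⁻¹ * (Y t₁ - Y t₂))) := by
    have ha := tendsto_left_average hY h₁ (h₁₂.trans h₂) hpos hlt hlim
    have hb := tendsto_left_average hY (h₁.trans h₁₂) h₂ hpos (fun n => (hlt n).trans h₁₂) hlim
    refine ((ha.sub hb).const_mul r⁻¹).congr fun n => ?_
    simp only [hLn, mul_inv]; ring
  -- On the window the lower kernel bound multiplies a product that is nonnegative by monotonicity
  -- of powers; off the window both sides vanish.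
  have hdens : ∀ᵐ q ∂μ, C₁ * (Ioc t₁ t₂).indicator
      (fun τ => powerDensity s p r (v τ) q.2.1 q.2.2) q.1 ≤ E f q := by
    filter_upwards [hKb] with q hq
    set m : ℝ := ‖q.2.1 - q.2.2‖ ^ ((N : ℝ) + p * s) with hm
    have hm0 : 0 ≤ m := by positivity
    have hmpos : 0 < m := by
      rcases hm0.eq_or_lt with h | h
      · rw [← h] at hq; linarith [hq.1]
      · exact h
    have hKge : C₁ / m ≤ K q.2.1 q.2.2 q.1 := by rw [div_le_iff₀ hmpos]; exact hq.1
    by_cases hτ : q.1 ∈ Ioc t₁ t₂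
    · simp only [hE, hf, cutPow, indicator_of_mem hτ, powerDensity]
      have hn := sub_mul_rpow_sub_nonneg (hv0 q.1 q.2.1) (hv0 q.1 q.2.2) hr1
      rw [← hm, mul_div_assoc', mul_comm C₁, mul_div_assoc]
      refine mul_le_mul_of_nonneg_left hKge ?_
      rw [mul_assoc]
      positivity
    · simp only [hE, hf, cutPow, indicator_of_notMem hτ]
      simp
  have hE0 : 0 ≤ᵐ[μ] E f := by
    filter_upwards [hdens] with q hq
    refine le_trans (mul_nonneg hC₁.le ?_) hq
    exact indicator_nonneg (fun τ _ => powerDensity_nonneg (by linarith) (hv0 τ) _ _) _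
  -- The dominating functions are the energy densities of v and of the averaged test functions. The
  -- integrals of the latter stay below that of the limit by the Steklov contraction.
  have hmain := lintegral_ofReal_le_of_tendsto (μ := μ) (P := E f) (Pn := fun n => E (φ n))
    (D := G v) (A := G f) (An := fun n => G (φ n)) (hC₁.le.trans hC) (fun n => hEm (hφm n)) (hGint hv hG)
    (hGint hfm hGf2) hGφint (hG0 v) (hG0 f) hE0 hbound
    (by
      filter_upwards [hconv] with q hq
      exact (hq.const_mul _).mul_const _)
    (by
      filter_upwards [hconv] with q hq
      exact (hq.abs.rpow_const (Or.inr (by linarith))).div_const _)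
    (by
      intro n
      rw [integral_eq_lintegral_of_nonneg_ae (Eventually.of_forall (hG0 _))
          (hGφint n).aestronglyMeasurable,
        integral_eq_lintegral_of_nonneg_ae (Eventually.of_forall (hG0 _))
          (hGint hfm hGf2).aestronglyMeasurable]
      have e1 := lintegral_gagliardo_eq (s := s) (p := p) (hφm n) (volume.restrict (Ioo 0 S))
      have e2 := lintegral_gagliardo_eq (s := s) (p := p) hfm (volume.restrict (Ioo 0 S))
      refine ENNReal.toReal_mono ?_ ?_
      · rw [← e2]; exact hGf2.ne
      · rw [← e1, ← e2]; exact hGφle n)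
    hL hLlim
  refine ⟨hmain.1, le_trans ?_ hmain.2⟩
  calc _ = ∫⁻ τ in Ioo 0 S, (Ioc t₁ t₂).indicator (fun τ => ENNReal.ofReal C₁ *
        ∫⁻ z : Space N × Space N, ENNReal.ofReal (powerDensity s p r (v τ) z.1 z.2)) τ := by
        rw [setLIntegral_indicator measurableSet_Ioc, inter_eq_self_of_subset_left hsub,
          lintegral_const_mul' _ _ ENNReal.ofReal_ne_top]
    _ = ∫⁻ τ in Ioo 0 S, ∫⁻ z : Space N × Space N, ENNReal.ofReal (C₁ *
        (Ioc t₁ t₂).indicator (fun τ => powerDensity s p r (v τ) z.1 z.2) τ) := by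
        refine lintegral_congr fun τ => ?_
        by_cases hτ : τ ∈ Ioc t₁ t₂
        · simp only [indicator_of_mem hτ]
          rw [← lintegral_const_mul' _ _ ENNReal.ofReal_ne_top]
          exact lintegral_congr fun z => (ENNReal.ofReal_mul hC₁.le).symm
        · simp only [indicator_of_notMem hτ]
          simp
    _ ≤ ∫⁻ τ in Ioo 0 S, ∫⁻ z : Space N × Space N, ENNReal.ofReal (E f (τ, z)) := by
        refine lintegral_mono_ae ?_
        filter_upwards [Measure.ae_ae_of_ae_prod hdens] with τ hτ
        refine lintegral_mono_ae ?_
        filter_upwards [hτ] with z hz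
        exact ENNReal.ofReal_le_ofReal hz
    _ = _ := (lintegral_prod _ (hEm hfm).aemeasurable.ennreal_ofReal).symm


/-! ### From almost every time to every time; bounded representatives -/

theorem measurableSet_timeInterval (T : EReal) : MeasurableSet (timeInterval T) :=
  (measurableSet_lt measurable_const measurable_id).inter
    (measurableSet_lt measurable_coe_real_ereal measurable_const)

theorem Ioo_subset_timeInterval {S : ℝ} {T : EReal} (h : (S : EReal) ≤ T) :
    Ioo 0 S ⊆ timeInterval T := fun _ ht =>
  ⟨ht.1, (EReal.coe_lt_coe_iff.2 ht.2).trans_le h⟩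

/-- The reordering `(t, (x, y)) ↦ (x, (y, t))` is quasi-measure-preserving on time slabs. -/
theorem quasiMeasurePreserving_reorder {N : ℕ} {S : ℝ} {T : EReal} (h : (S : EReal) ≤ T) :
    Measure.QuasiMeasurePreserving
      (fun q : ℝ × (Space N × Space N) => ((q.2.1, q.2.2, q.1) : Space N × Space N × ℝ))
      ((volume.restrict (Ioo 0 S)).prod volume)
      (volume.restrict {z | z.2.2 ∈ timeInterval T}) := by
  have h1 : MeasurePreserving
      (fun q : ℝ × (Space N × Space N) => ((q.2.1, q.2.2, q.1) : Space N × Space N × ℝ))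
      ((volume : Measure ℝ).prod (volume : Measure (Space N × Space N))) volume :=
    (measurePreserving_prodAssoc (volume : Measure (Space N)) (volume : Measure (Space N))
      (volume : Measure ℝ)).comp Measure.measurePreserving_swap
  have hm : MeasurableSet {z : Space N × Space N × ℝ | z.2.2 ∈ timeInterval T} :=
    measurable_snd.snd (measurableSet_timeInterval T)
  refine (h1.restrict_preimage hm).quasiMeasurePreserving.mono_left ?_
  have e : ((volume : Measure ℝ).restrict (Ioo 0 S)).prod (volume : Measure (Space N × Space N)) =
      ((volume : Measure ℝ).prod volume).restrict (Ioo 0 S ×ˢ univ) := by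
    rw [← Measure.prod_restrict, Measure.restrict_univ]
  rw [e]
  refine (Measure.restrict_mono (fun q hq => ?_) le_rfl).absolutelyContinuous
  exact Ioo_subset_timeInterval h hq.1

/-- A subset of full measure of `(0, S)` accumulates at every point of `[0, S]`. -/
theorem frequently_of_ae_Ioo {S t : ℝ} (hS : 0 < S) (ht : t ∈ Icc 0 S) {P : ℝ → Prop}
    (h : ∀ᵐ τ ∂(volume.restrict (Ioo 0 S)), P τ) : ∃ᶠ τ in 𝓝[Icc 0 S] t, P τ := by
  intro hnot
  rw [eventually_nhdsWithin_iff] at hnot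
  obtain ⟨U, hU, hUo, htU⟩ := eventually_nhds_iff.1 hnot
  have hcl : t ∈ closure (Ioo 0 S) := by rwa [closure_Ioo hS.ne]
  have hne : (U ∩ Ioo 0 S).Nonempty := mem_closure_iff.1 hcl U hUo htU
  have hpos := (hUo.inter isOpen_Ioo).measure_pos volume hne
  rw [ae_restrict_iff' measurableSet_Ioo, ae_iff] at h
  refine hpos.ne' (measure_mono_null ?_ h)
  intro τ hτ
  simp only [mem_ofPred_eq, not_forall]
  exact ⟨hτ.2, hU τ hτ.1 ⟨hτ.2.1.le, hτ.2.2.le⟩⟩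

/-- Almost everywhere bounds in space-time hold at every time, by continuity in `L²`. -/
theorem MemCL2.forall_mem_Icc {N : ℕ} {Ω : Set (Space N)} {S M : ℝ} {u : ℝ → Space N → ℝ}
    (hS : 0 < S) (hu : MemCL2 Ω S u)
    (hb : ∀ᵐ t ∂(volume.restrict (Ioo 0 S)), ∀ᵐ x ∂(volume.restrict Ω), u t x ∈ Icc 0 M)
    {t : ℝ} (ht : t ∈ Icc 0 S) : ∀ᵐ x ∂(volume.restrict Ω), u t x ∈ Icc 0 M := by
  -- `w` measures how far u(t) leaves [0, M]. It is dominated by |u(τ) - u(t)| whenever u(τ) takes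
  -- values in [0, M], and such τ accumulate at t, so its L² norm is zero.
  set w : Space N → ℝ := fun x => max (u t x - M) 0 + max (-u t x) 0 with hw
  have hwm : AEStronglyMeasurable w (volume.restrict Ω) := by
    have hm := (hu.memLp t ht).1.aemeasurable
    exact (((hm.sub_const M).max aemeasurable_const).add
      (hm.neg.max aemeasurable_const)).aestronglyMeasurable
  have hle : eLpNorm w 2 (volume.restrict Ω) ≤ 0 := by
    refine ge_of_tendsto_of_frequently (hu.continuous t ht) ?_
    refine (frequently_of_ae_Ioo hS ht hb).mono fun τ hτ => ?_
    refine eLpNorm_mono_ae ?_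
    filter_upwards [hτ] with x hx
    rw [Real.norm_eq_abs, Real.norm_eq_abs]
    have h1 := le_abs_self (u τ x - u t x)
    have h2 := neg_abs_le (u τ x - u t x)
    obtain ⟨h3, h4⟩ := hx
    simp only [hw]
    rw [abs_of_nonneg (by positivity)]
    rcases le_total (u t x - M) 0 with h5 | h5 <;> rcases le_total (-u t x) 0 with h6 | h6
    · rw [max_eq_right h5, max_eq_right h6]; simp
    · rw [max_eq_right h5, max_eq_left h6]; linarith
    · rw [max_eq_left h5, max_eq_right h6]; linarith
    · rw [max_eq_left h5, max_eq_left h6]; linarith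
  have h0 := (eLpNorm_eq_zero_iff hwm two_ne_zero).1 (le_antisymm hle zero_le)
  filter_upwards [h0] with x hx
  have h1 : 0 ≤ max (u t x - M) 0 := le_max_right _ _
  have h2 : 0 ≤ max (-u t x) 0 := le_max_right _ _
  simp only [hw, Pi.zero_apply] at hx
  have h3 := le_max_left (u t x - M) 0
  have h4 := le_max_left (-u t x) 0
  exact ⟨by linarith, by linarith⟩

/-- The power is Lipschitz on [0, M] and Ω has finite measure, so L² continuity of u gives L¹
continuity of u^r. -/
theorem MemCL2.continuousOn_integral_rpow {N : ℕ} {Ω : Set (Space N)} (hΩ : volume Ω < ⊤)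
    {S M r : ℝ} (hr : 1 ≤ r) {u : ℝ → Space N → ℝ} (hu : MemCL2 Ω S u)
    (hb : ∀ t ∈ Icc 0 S, ∀ᵐ x ∂(volume.restrict Ω), u t x ∈ Icc 0 M) :
    ContinuousOn (fun t => ∫ x in Ω, u t x ^ r) (Icc 0 S) := by
  have : IsFiniteMeasure (volume.restrict Ω) := ⟨by simpa using hΩ⟩
  have hm : ∀ t ∈ Icc 0 S, AEStronglyMeasurable (fun x => u t x ^ r) (volume.restrict Ω) :=
    fun t ht => ((hu.memLp t ht).1.aemeasurable.pow_const r).aestronglyMeasurable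
  have hi : ∀ t ∈ Icc 0 S, Integrable (fun x => u t x ^ r) (volume.restrict Ω) := by
    intro t ht
    refine Integrable.of_bound (hm t ht) (M ^ r) ?_
    filter_upwards [hb t ht] with x hx
    rw [Real.norm_eq_abs, abs_of_nonneg (Real.rpow_nonneg hx.1 _)]
    exact Real.rpow_le_rpow hx.1 hx.2 (by linarith)
  intro t₀ ht₀
  refine tendsto_integral_of_L1' _ (hm t₀ ht₀) (eventually_mem_nhdsWithin.mono hi) ?_
  have hC : Tendsto (fun t => ENNReal.ofReal (r * M ^ (r - 1)) *
      (eLpNorm (fun x => u t x - u t₀ x) 2 (volume.restrict Ω) *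
        (volume.restrict Ω) univ ^ (1 / (1 : ℝ≥0∞).toReal - 1 / (2 : ℝ≥0∞).toReal)))
      (𝓝[Icc 0 S] t₀) (𝓝 0) := by
    have h1 := ENNReal.Tendsto.mul_const
      (b := (volume.restrict Ω) univ ^ (1 / (1 : ℝ≥0∞).toReal - 1 / (2 : ℝ≥0∞).toReal))
      (hu.continuous t₀ ht₀)
      (Or.inr (ENNReal.rpow_ne_top_of_nonneg (by norm_num) (measure_ne_top _ _)))
    have h2 := ENNReal.Tendsto.const_mul (a := ENNReal.ofReal (r * M ^ (r - 1))) h1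
      (Or.inr ENNReal.ofReal_ne_top)
    simpa using h2
  refine tendsto_of_tendsto_of_tendsto_of_le_of_le' tendsto_const_nhds hC
    (Eventually.of_forall fun _ => zero_le) ?_
  filter_upwards [self_mem_nhdsWithin] with t ht
  have hsub : AEStronglyMeasurable (fun x => u t x - u t₀ x) (volume.restrict Ω) :=
    (hu.memLp t ht).1.sub (hu.memLp t₀ ht₀).1
  refine le_trans (eLpNorm_le_mul_eLpNorm_of_ae_le_mul (c := r * M ^ (r - 1))
    (g := fun x => u t x - u t₀ x) ?_ 1) ?_
  · filter_upwards [hb t ht, hb t₀ ht₀] with x hx hx₀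
    exact abs_rpow_sub_rpow_le hr hx.1 hx.2 hx₀.1 hx₀.2
  · exact mul_le_mul_right (eLpNorm_le_eLpNorm_mul_rpow_measure_univ (by norm_num) hsub) _

theorem gagliardo_congr_ae {N : ℕ} {s p : ℝ} {v w : Space N → ℝ} (h : v =ᵐ[volume] w) :
    gagliardo N s p v = gagliardo N s p w := by
  have h1 : ∀ᵐ z : Space N × Space N, v z.1 = w z.1 :=
    Measure.quasiMeasurePreserving_fst.ae h
  have h2 : ∀ᵐ z : Space N × Space N, v z.2 = w z.2 :=
    Measure.quasiMeasurePreserving_snd.ae h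
  refine lintegral_congr_ae ?_
  filter_upwards [h1, h2] with z hz1 hz2
  rw [hz1, hz2]

theorem energyForm_congr_ae {N : ℕ} {p : ℝ} {k : Space N → Space N → ℝ} {v w φ : Space N → ℝ}
    (h : v =ᵐ[volume] w) : energyForm p k v φ = energyForm p k w φ := by
  have h1 : ∀ᵐ z : Space N × Space N, v z.1 = w z.1 :=
    Measure.quasiMeasurePreserving_fst.ae h
  have h2 : ∀ᵐ z : Space N × Space N, v z.2 = w z.2 :=
    Measure.quasiMeasurePreserving_snd.ae h
  refine integral_congr_ae ?_
  filter_upwards [h1, h2] with z hz1 hz2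
  rw [hz1, hz2]

/-- A bounded weak solution has a measurable bounded representative vanishing outside `Ω`. -/
theorem exists_bounded_representative {N : ℕ} {s p S M : ℝ} {Ω : Set (Space N)}
    (hΩm : MeasurableSet Ω) (hM : 0 ≤ M) {u : ℝ → Space N → ℝ} (hu : MemLpWsp0 s p Ω S u)
    (hb : ∀ᵐ t ∂(volume.restrict (Ioo 0 S)), ∀ᵐ x, u t x ∈ Icc 0 M) :
    ∃ v : ℝ → Space N → ℝ, Measurable (fun z : ℝ × Space N => v z.1 z.2) ∧
      (∀ t x, 0 ≤ v t x) ∧ (∀ t x, v t x ≤ M) ∧ (∀ t, ∀ x ∉ Ω, v t x = 0) ∧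
      ∀ᵐ t ∂(volume.restrict (Ioo 0 S)), v t =ᵐ[volume] u t := by
  have hae := hu.aestronglyMeasurable
  set w : ℝ × Space N → ℝ := hae.mk _ with hw
  have hwm : Measurable w := hae.stronglyMeasurable_mk.measurable
  -- A jointly measurable modification, truncated to [0, M] and set to zero off Ω, so that the
  -- bounds hold everywhere instead of almost everywhere.
  refine ⟨fun t x => (univ ×ˢ Ω : Set (ℝ × Space N)).indicator
    (fun z => min (max (w z) 0) M) (t, x), ?_, ?_, ?_, ?_, ?_⟩
  · exact ((hwm.max measurable_const).min measurable_const).indicator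
      (MeasurableSet.univ.prod hΩm)
  · exact fun t x => indicator_nonneg (fun z _ => le_min (le_max_right _ _) hM) _
  · intro t x
    beta_reduce
    by_cases hx : x ∈ Ω
    · rw [indicator_of_mem (show (t, x) ∈ univ ×ˢ Ω from ⟨trivial, hx⟩)]; exact min_le_right _ _
    · rw [indicator_of_notMem (by simpa using hx)]; exact hM
  · intro t x hx
    exact indicator_of_notMem (by simpa using hx) _
  · filter_upwards [Measure.ae_ae_of_ae_prod hae.ae_eq_mk, hb, hu.mem] with t h1 h2 h3
    filter_upwards [h1, h2, (ae_restrict_iff' hΩm.compl).1 h3.eq_zero] with x hx1 hx2 hx3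
    by_cases hx : x ∈ Ω
    · rw [indicator_of_mem (show (t, x) ∈ univ ×ˢ Ω from ⟨trivial, hx⟩), hw, ← hx1, max_eq_left hx2.1,
        min_eq_left hx2.2]
    · rw [indicator_of_notMem (by simpa using hx), hx3 hx]


/-! ### Integrated coercivity in the two ranges of p -/

theorem lintegral_ofReal_rpow_eq {N : ℕ} {Ω : Set (Space N)} (hΩm : MeasurableSet Ω)
    (hΩ : volume Ω < ⊤) {w : Space N → ℝ} {M e : ℝ} (he : 0 < e) (hw : Measurable w)
    (hw0 : ∀ x, 0 ≤ w x) (hwM : ∀ x, w x ≤ M) (hwΩ : ∀ x ∉ Ω, w x = 0) :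
    ∫⁻ x, ENNReal.ofReal (w x ^ e) = ENNReal.ofReal (∫ x in Ω, w x ^ e) := by
  have : IsFiniteMeasure (volume.restrict Ω) := ⟨by simpa using hΩ⟩
  have hi : Integrable (fun x => w x ^ e) (volume.restrict Ω) :=
    Integrable.of_bound (hw.pow_const e).aestronglyMeasurable (M ^ e)
      (Eventually.of_forall fun x => by
        rw [Real.norm_eq_abs, abs_of_nonneg (Real.rpow_nonneg (hw0 x) _)]
        exact Real.rpow_le_rpow (hw0 x) (hwM x) he.le)
  rw [ofReal_integral_eq_lintegral_ofReal hi
    (Eventually.of_forall fun x => Real.rpow_nonneg (hw0 x) _), ← lintegral_indicator hΩm]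
  refine lintegral_congr fun x => ?_
  by_cases hx : x ∈ Ω
  · rw [indicator_of_mem hx]
  · rw [indicator_of_notMem hx, hwΩ x hx, Real.zero_rpow he.ne', ENNReal.ofReal_zero]

/-- Integrated coercivity of the energy tested with a power. -/
theorem exists_integral_coercivity (N : ℕ) (hN : 1 ≤ N) {s p r : ℝ} (hs : 0 < s) (hp : 1 < p)
    (hr : 2 ≤ r) :
    ∃ C : ℝ, 0 < C ∧ ∀ (Ω : Set (Space N)), MeasurableSet Ω → volume Ω < ⊤ →
      ∀ (w : Space N → ℝ) (M : ℝ), Measurable w → (∀ x, 0 ≤ w x) → (∀ x, w x ≤ M) →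
      (∀ x ∉ Ω, w x = 0) → 0 < ∫ x in Ω, w x ^ r →
      ENNReal.ofReal (∫ x in Ω, w x ^ (p + r - 2 + r * (p * s / N))) ≤
        ENNReal.ofReal (C * (∫ x in Ω, w x ^ r) ^ (p * s / N)) *
          ∫⁻ z : Space N × Space N, ENNReal.ofReal (powerDensity s p r w z.1 z.2) := by
  obtain ⟨C, hC, h⟩ := exists_pointwise_coercivity N hN hs hp (by linarith : 1 < r)
  refine ⟨C, hC, fun Ω hΩm hΩ w M hw hw0 hwM hwΩ hI => ?_⟩
  have he : 0 < p + r - 2 + r * (p * s / N) := by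
    have : 0 ≤ r * (p * s / N) := by positivity
    linarith
  rw [← lintegral_ofReal_rpow_eq hΩm hΩ he hw hw0 hwM hwΩ]
  have hpt := h w hw hw0 _ hI
    (lintegral_ofReal_rpow_eq hΩm hΩ (by linarith) hw hw0 hwM hwΩ).le
  refine (lintegral_mono hpt).trans ?_
  rw [lintegral_const_mul' _ _ ENNReal.ofReal_ne_top, Measure.volume_eq_prod,
    lintegral_prod _ (measurable_powerDensity hw).ennreal_ofReal.aemeasurable]

/-- Cancelling a power in a coercivity estimate. -/
theorem ofReal_rpow_le_of_le {I C κ e : ℝ} {G : ℝ≥0∞} (hI : 0 < I)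
    (h : ENNReal.ofReal (I ^ e) ≤ ENNReal.ofReal (C * I ^ κ) * G) :
    ENNReal.ofReal (I ^ (e - κ)) ≤ ENNReal.ofReal C * G := by
  have h1 : I ^ (e - κ) = (I ^ κ)⁻¹ * I ^ e := by
    rw [Real.rpow_sub hI, div_eq_inv_mul]
  have h2 : (I ^ κ)⁻¹ * (C * I ^ κ) = C := by
    field_simp
  calc ENNReal.ofReal (I ^ (e - κ)) = ENNReal.ofReal (I ^ κ)⁻¹ * ENNReal.ofReal (I ^ e) := by
        rw [h1, ENNReal.ofReal_mul (by positivity)]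
    _ ≤ ENNReal.ofReal (I ^ κ)⁻¹ * (ENNReal.ofReal (C * I ^ κ) * G) := mul_le_mul_right h _
    _ = ENNReal.ofReal C * G := by
        rw [← mul_assoc, ← ENNReal.ofReal_mul (by positivity), h2]

/-- Coercivity in the subcritical range `p < p_c`. -/
theorem exists_coercivity_of_lt_pCrit (N : ℕ) (hN : 1 ≤ N) {s p : ℝ} (hs : 0 < s) (hp : 1 < p)
    (hpc : p < pCrit N s) :
    ∃ C : ℝ, 0 < C ∧ ∀ (Ω : Set (Space N)), MeasurableSet Ω → volume Ω < ⊤ →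
      ∀ (w : Space N → ℝ) (M : ℝ), Measurable w → (∀ x, 0 ≤ w x) → (∀ x, w x ≤ M) →
      (∀ x ∉ Ω, w x = 0) →
      ENNReal.ofReal ((∫ x in Ω, w x ^ (N * (2 - p) / (p * s))) ^ (1 - p * s / N)) ≤
        ENNReal.ofReal C * ∫⁻ z : Space N × Space N,
          ENNReal.ofReal (powerDensity s p (N * (2 - p) / (p * s)) w z.1 z.2) := by
  have hNpos : (0 : ℝ) < N := by exact_mod_cast hN
  have hps : 0 < p * s := by positivity
  have hlt : p * (N + 2 * s) < 2 * N := by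
    rwa [pCrit, lt_div_iff₀ (by positivity)] at hpc
  have hr : 2 ≤ N * (2 - p) / (p * s) := by
    rw [le_div_iff₀ hps]; nlinarith
  have hpsN : p * s / N < 1 := by
    rw [div_lt_one hNpos]; nlinarith
  set r : ℝ := N * (2 - p) / (p * s) with hrdef
  -- The choice of q: precisely for r = N(2-p)/(ps) the terms p - 2 and rps/N cancel, so the
  -- coercivity estimate closes in ∫ w^r alone.
  have hexp : p + r - 2 + r * (p * s / N) = r := by
    rw [hrdef]; field_simp; ring
  obtain ⟨C, hC, h⟩ := exists_integral_coercivity N hN hs hp hr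
  refine ⟨C, hC, fun Ω hΩm hΩ w M hw hw0 hwM hwΩ => ?_⟩
  have hI0 : 0 ≤ ∫ x in Ω, w x ^ r := integral_nonneg fun x => Real.rpow_nonneg (hw0 x) _
  rcases hI0.eq_or_lt with h0 | hI
  · rw [← h0, Real.zero_rpow (by linarith), ENNReal.ofReal_zero]
    exact zero_le
  · have := h Ω hΩm hΩ w M hw hw0 hwM hwΩ hI
    rw [hexp] at this
    refine ofReal_rpow_le_of_le hI (le_trans ?_ this)
    rw [Real.rpow_one]

/-- Jensen's inequality for powers of an integral over a set of finite measure. -/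
theorem integral_rpow_le {N : ℕ} {Ω : Set (Space N)} (hΩ : volume Ω < ⊤) (hΩ0 : volume Ω ≠ 0)
    {w : Space N → ℝ} {M a : ℝ} (ha : 2 ≤ a) (hw : Measurable w) (hw0 : ∀ x, 0 ≤ w x)
    (hwM : ∀ x, w x ≤ M) :
    (∫ x in Ω, w x ^ (2 : ℝ)) ^ (a / 2) ≤
      (volume Ω).toReal ^ (a / 2 - 1) * ∫ x in Ω, w x ^ a := by
  have : IsFiniteMeasure (volume.restrict Ω) := ⟨by simpa using hΩ⟩
  have hi : ∀ e : ℝ, 0 ≤ e → Integrable (fun x => w x ^ e) (volume.restrict Ω) := fun e he =>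
    Integrable.of_bound (hw.pow_const e).aestronglyMeasurable (M ^ e)
      (Eventually.of_forall fun x => by
        rw [Real.norm_eq_abs, abs_of_nonneg (Real.rpow_nonneg (hw0 x) _)]
        exact Real.rpow_le_rpow (hw0 x) (hwM x) he)
  have he : ∀ x, (w x ^ (2 : ℝ)) ^ (a / 2) = w x ^ a := fun x => by
    rw [← Real.rpow_mul (hw0 x)]; congr 1; ring
  have hJ := (convexOn_rpow (by linarith : 1 ≤ a / 2)).map_set_average_le (μ := volume) (t := Ω)
    (f := fun x => w x ^ (2 : ℝ)) (continuousOn_id.rpow_const fun x _ => Or.inr (by linarith))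
    isClosed_Ici hΩ0 hΩ.ne (Eventually.of_forall fun x => mem_Ici.2 (Real.rpow_nonneg (hw0 x) _))
    (hi 2 (by norm_num)) (by
      have := hi a (by linarith)
      refine this.congr (Eventually.of_forall fun x => ?_)
      simp only [Function.comp, he])
  simp only [he] at hJ
  have hV : 0 < (volume Ω).toReal := ENNReal.toReal_pos hΩ0 hΩ.ne
  have hI0 : 0 ≤ ∫ x in Ω, w x ^ (2 : ℝ) := integral_nonneg fun x => Real.rpow_nonneg (hw0 x) _
  rw [setAverage_eq, setAverage_eq, measureReal_def, smul_eq_mul, smul_eq_mul,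
    Real.mul_rpow (by positivity) hI0, Real.inv_rpow hV.le, inv_mul_le_iff₀ (by positivity)] at hJ
  rw [Real.rpow_sub hV, Real.rpow_one]
  calc _ ≤ _ := hJ
    _ = _ := by ring

/-- Coercivity in the range `p_c ≤ p < 2`. -/
theorem exists_coercivity_of_pCrit_le (N : ℕ) (hN : 1 ≤ N) {s p : ℝ} (hs : 0 < s) (hp : 1 < p)
    (hpc : pCrit N s ≤ p) :
    ∃ C : ℝ, 0 < C ∧ ∀ (Ω : Set (Space N)), MeasurableSet Ω → volume Ω < ⊤ →
      ∀ (w : Space N → ℝ) (M : ℝ), Measurable w → (∀ x, 0 ≤ w x) → (∀ x, w x ≤ M) →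
      (∀ x ∉ Ω, w x = 0) →
      ENNReal.ofReal ((∫ x in Ω, w x ^ (2 : ℝ)) ^ (p / 2)) ≤
        ENNReal.ofReal (C * (volume Ω).toReal ^ (lam N s p 2 / (2 * N))) *
          ∫⁻ z : Space N × Space N, ENNReal.ofReal (powerDensity s p 2 w z.1 z.2) := by
  have hNpos : (0 : ℝ) < N := by exact_mod_cast hN
  have hps : 0 < p * s := by positivity
  have hle : 2 * N ≤ p * (N + 2 * s) := by
    rwa [pCrit, div_le_iff₀ (by positivity)] at hpc
  -- The coercivity exponent at r = 2. The condition p ≥ p_c is equivalent to a ≥ 2, the range where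
  -- Jensen compares ∫ w² with ∫ w^a; its volume exponent a/2 - 1 equals λ₂/(2N).
  set a : ℝ := p + 2 * (p * s / N) with ha
  have ha2 : 2 ≤ a := by
    rw [ha, ← sub_nonneg]
    have e : p + 2 * (p * s / N) - 2 = (p * (N + 2 * s) - 2 * N) / N := by field_simp
    rw [e]
    exact div_nonneg (by linarith) hNpos.le
  have hlam : a / 2 - 1 = lam N s p 2 / (2 * N) := by
    rw [ha, lam]; field_simp; ring
  obtain ⟨C, hC, h⟩ := exists_integral_coercivity N hN hs hp (le_refl (2 : ℝ))
  refine ⟨C, hC, fun Ω hΩm hΩ w M hw hw0 hwM hwΩ => ?_⟩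
  have hI0 : 0 ≤ ∫ x in Ω, w x ^ (2 : ℝ) := integral_nonneg fun x => Real.rpow_nonneg (hw0 x) _
  rcases hI0.eq_or_lt with h0 | hI
  · rw [← h0, Real.zero_rpow (by linarith), ENNReal.ofReal_zero]
    exact zero_le
  · have hΩ0 : volume Ω ≠ 0 := by
      intro h0
      rw [Measure.restrict_eq_zero.2 h0, integral_zero_measure] at hI
      exact hI.false
    have h1 := h Ω hΩm hΩ w M hw hw0 hwM hwΩ hI
    have hexp : p + 2 - 2 + 2 * (p * s / N) = a := by rw [ha]; ring
    rw [hexp] at h1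
    have hV : 0 ≤ (volume Ω).toReal ^ (a / 2 - 1) := by positivity
    have h2 : ENNReal.ofReal ((∫ x in Ω, w x ^ (2 : ℝ)) ^ (a / 2)) ≤
        ENNReal.ofReal (C * (volume Ω).toReal ^ (a / 2 - 1) *
          (∫ x in Ω, w x ^ (2 : ℝ)) ^ (p * s / N)) *
          ∫⁻ z : Space N × Space N, ENNReal.ofReal (powerDensity s p 2 w z.1 z.2) := by
      calc _ ≤ ENNReal.ofReal ((volume Ω).toReal ^ (a / 2 - 1) * ∫ x in Ω, w x ^ a) :=
            ENNReal.ofReal_le_ofReal (integral_rpow_le hΩ hΩ0 ha2 hw hw0 hwM)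
        _ = ENNReal.ofReal ((volume Ω).toReal ^ (a / 2 - 1)) *
            ENNReal.ofReal (∫ x in Ω, w x ^ a) := ENNReal.ofReal_mul hV
        _ ≤ _ := mul_le_mul_right h1 _
        _ = _ := by
            rw [← mul_assoc, ← ENNReal.ofReal_mul hV]
            congr 2; ring
    have h3 := ofReal_rpow_le_of_le hI h2
    have hθ : a / 2 - p * s / N = p / 2 := by rw [ha]; ring
    rwa [hθ, hlam] at h3


/-! ### Extinction of weak solutions -/

/-- Extinction of bounded nonnegative weak solutions on a finite time interval, given a coercivity
estimate for the energy tested with the power `r - 1`. -/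
theorem IsWeakSolutionOn.eq_zero_of_coercivity {N : ℕ} {s p C₁ C₂ S M r θ A : ℝ} {T : EReal}
    (hS : 0 < S) (hST : (S : EReal) ≤ T) (hp : 1 < p) (hr : 2 ≤ r)
    (hθ : 0 < θ) (hθ1 : θ < 1) (hA : 0 ≤ A) (hC₁ : 0 < C₁) (hC : C₁ ≤ C₂) (hM : 0 ≤ M)
    {Ω : Set (Space N)} (hΩm : MeasurableSet Ω) (hΩ : volume Ω < ⊤)
    {K : Space N → Space N → ℝ → ℝ} (hK : KernelCond s p C₁ C₂ T K)
    (hcoer : ∀ w : Space N → ℝ, Measurable w → (∀ x, 0 ≤ w x) → (∀ x, w x ≤ M) →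
      (∀ x ∉ Ω, w x = 0) → ENNReal.ofReal ((∫ x in Ω, w x ^ r) ^ θ) ≤ ENNReal.ofReal A *
        ∫⁻ z : Space N × Space N, ENNReal.ofReal (powerDensity s p r w z.1 z.2))
    {u₀ : Space N → ℝ} {u : ℝ → Space N → ℝ} (hu : IsWeakSolutionOn s p Ω K u₀ S u)
    (hb : ∀ᵐ t ∂(volume.restrict (Ioo 0 S)), ∀ᵐ x, u t x ∈ Icc 0 M)
    {t : ℝ} (ht0 : 0 < t) (htS : t ≤ S)
    (ht : A / (r * C₁) * (∫ x in Ω, u 0 x ^ r) ^ (1 - θ) / (1 - θ) < t) :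
    u t =ᵐ[volume] 0 := by
  have hbΩ : ∀ τ ∈ Icc 0 S, ∀ᵐ x ∂(volume.restrict Ω), u τ x ∈ Icc 0 M := fun τ hτ =>
    hu.memCL2.forall_mem_Icc hS (hb.mono fun _ h => ae_restrict_of_ae h) hτ
  have hr0 : 0 < r := by linarith
  set Y : ℝ → ℝ := fun t => ∫ x in Ω, u t x ^ r with hY
  have hYc : ContinuousOn Y (Icc 0 S) :=
    hu.memCL2.continuousOn_integral_rpow hΩ (by linarith) hbΩ
  have hY0 : ∀ τ ∈ Icc 0 S, 0 ≤ Y τ := fun τ hτ =>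
    integral_nonneg_of_ae ((hbΩ τ hτ).mono fun x hx => Real.rpow_nonneg hx.1 _)
  -- The energy argument runs on the representative v, while Y stays defined by u, whose time
  -- continuity and initial value are needed.
  obtain ⟨v, hv, hv0, hvM, hvΩ, hvu⟩ := exists_bounded_representative hΩm hM hu.memLpWsp0 hb
  have hG : ∫⁻ t in Ioo 0 S, gagliardo N s p (v t) < ⊤ := by
    refine lt_of_le_of_lt ?_ hu.memLpWsp0.norm_lt_top
    refine lintegral_mono_ae ?_
    filter_upwards [hvu] with τ hτ
    rw [gagliardo_congr_ae hτ]
    exact le_add_self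
  have hYv : ∀ᵐ τ ∂(volume.restrict (Ioo 0 S)), ∫ x in Ω, v τ x ^ r = Y τ := by
    filter_upwards [hvu] with τ hτ
    refine integral_congr_ae (ae_restrict_of_ae ?_)
    filter_upwards [hτ] with x hx
    rw [hx]
  have hweak : ∀ φ φ' : ℝ → Space N → ℝ, MemW12L2 Ω S φ φ' → MemLpWsp0 s p Ω S φ →
      (∀ x, φ 0 x = 0) → (∀ x, φ S x = 0) →
      ∫ τ in Ioo 0 S, energyForm p (fun x y => K x y τ) (v τ) (φ τ) =
        ∫ τ in Ioo 0 S, ∫ x in Ω, v τ x * φ' τ x := by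
    intro φ φ' h1 h2 h3 h4
    have hw := hu.weak_form φ φ' h1 h2
    simp only [h3, h4, mul_zero, integral_zero, sub_zero, zero_sub] at hw
    have e1 : ∫ τ in Ioo 0 S, energyForm p (fun x y => K x y τ) (v τ) (φ τ) =
        ∫ τ in Ioo 0 S, energyForm p (fun x y => K x y τ) (u τ) (φ τ) := by
      refine integral_congr_ae ?_
      filter_upwards [hvu] with τ hτ
      exact energyForm_congr_ae hτ
    have e2 : ∫ τ in Ioo 0 S, ∫ x in Ω, v τ x * φ' τ x =
        ∫ τ in Ioo 0 S, ∫ x in Ω, u τ x * φ' τ x := by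
      refine integral_congr_ae ?_
      filter_upwards [hvu] with τ hτ
      refine integral_congr_ae (ae_restrict_of_ae ?_)
      filter_upwards [hτ] with x hx
      rw [hx]
    rw [e1, e2]
    linarith
  have hqm := quasiMeasurePreserving_reorder (N := N) hST
  have hKm := (hK.aemeasurable.comp_quasiMeasurePreserving hqm).aestronglyMeasurable
  have hKb := hqm.ae hK.bounds
  have hYθ : ContinuousOn (fun x => Y x ^ θ) (Icc 0 S) :=
    hYc.rpow_const fun x _ => Or.inr hθ.le
  -- Coercivity at almost every time, integrated and combined with the energy inequality, gives C₁ ∫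
  -- Y^θ ≤ A r⁻¹ (Y(t₁) - Y(t₂)).
  have hineq : ∀ t₁ t₂, 0 < t₁ → t₁ < t₂ → t₂ < S →
      ∫ t in t₁..t₂, Y t ^ θ ≤ A / (r * C₁) * (Y t₁ - Y t₂) := by
    intro t₁ t₂ h₁ h₁₂ h₂
    have hsub : Ioc t₁ t₂ ⊆ Ioo 0 S := fun t ht => ⟨h₁.trans ht.1, ht.2.trans_lt h₂⟩
    obtain ⟨hpos, hE⟩ := energy_inequality hp hr hC₁ hC hΩm hΩ hKm hKb hv hv0 hvM hvΩ hG hweak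
      hYc hYv h₁ h₁₂ h₂
    have hint : IntegrableOn (fun x => Y x ^ θ) (Ioc t₁ t₂) :=
      ((hYθ.mono (Icc_subset_Icc h₁.le h₂.le)).integrableOn_Icc).mono_set Ioc_subset_Icc_self
    have hnn : 0 ≤ᵐ[volume.restrict (Ioc t₁ t₂)] fun x => Y x ^ θ :=
      (ae_restrict_iff' measurableSet_Ioc).2 (Eventually.of_forall fun x hx =>
        Real.rpow_nonneg (hY0 x (Ioo_subset_Icc_self (hsub hx))) _)
    have h3 : ENNReal.ofReal (∫ t in t₁..t₂, Y t ^ θ) ≤ ENNReal.ofReal A *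
        ∫⁻ τ in Ioc t₁ t₂, ∫⁻ z : Space N × Space N,
          ENNReal.ofReal (powerDensity s p r (v τ) z.1 z.2) := by
      rw [intervalIntegral.integral_of_le h₁₂.le, ofReal_integral_eq_lintegral_ofReal hint hnn,
        ← lintegral_const_mul' _ _ ENNReal.ofReal_ne_top]
      refine lintegral_mono_ae ?_
      filter_upwards [ae_restrict_of_ae_restrict_of_subset hsub hYv] with τ hτ
      rw [← hτ]
      exact hcoer (v τ) (measurable_space_slice hv τ) (hv0 τ) (hvM τ) (hvΩ τ)
    have h4 : ENNReal.ofReal (C₁ * ∫ t in t₁..t₂, Y t ^ θ) ≤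
        ENNReal.ofReal (A * (r⁻¹ * (Y t₁ - Y t₂))) := by
      rw [ENNReal.ofReal_mul hC₁.le, ENNReal.ofReal_mul hA]
      calc _ ≤ _ := mul_le_mul_right h3 _
        _ = ENNReal.ofReal A * (ENNReal.ofReal C₁ * ∫⁻ τ in Ioc t₁ t₂, ∫⁻ z : Space N × Space N,
          ENNReal.ofReal (powerDensity s p r (v τ) z.1 z.2)) := mul_left_comm _ _ _
        _ ≤ _ := mul_le_mul_right hE _
    have h5 := (ENNReal.ofReal_le_ofReal_iff (mul_nonneg hA hpos)).1 h4
    rw [mul_comm, ← le_div_iff₀ hC₁] at h5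
    refine h5.trans (le_of_eq ?_)
    field_simp
  have hYt : Y t = 0 := eq_zero_of_integral_rpow_le hS hθ hθ1 (by positivity) hYc hY0 hineq
    ht0 htS ht
  have htm : t ∈ Icc 0 S := ⟨ht0.le, htS⟩
  have : IsFiniteMeasure (volume.restrict Ω) := ⟨by simpa using hΩ⟩
  have hi : Integrable (fun x => u t x ^ r) (volume.restrict Ω) := by
    refine Integrable.of_bound
      ((hu.memCL2.memLp t htm).1.aemeasurable.pow_const r).aestronglyMeasurable (M ^ r) ?_
    filter_upwards [hbΩ t htm] with x hx
    rw [Real.norm_eq_abs, abs_of_nonneg (Real.rpow_nonneg hx.1 _)]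
    exact Real.rpow_le_rpow hx.1 hx.2 hr0.le
  have hz := (integral_eq_zero_iff_of_nonneg_ae
    ((hbΩ t htm).mono fun x hx => Real.rpow_nonneg hx.1 _) hi).1 hYt
  refine ae_of_ae_restrict_of_ae_restrict_compl Ω ?_ (hu.eq_zero t htm)
  filter_upwards [hz, hbΩ t htm] with x hx hx0
  exact (Real.rpow_eq_zero hx0.1 hr0.ne').1 hx

/-- The extinction time attached to a coercivity estimate. -/
theorem extinction_of_coercivity {N : ℕ} {s p C₁ C₂ r θ A : ℝ} {T : EReal} (hp : 1 < p)
    (hr : 2 ≤ r) (hθ : 0 < θ) (hθ1 : θ < 1) (hrθ : r * (1 - θ) = 2 - p)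
    (hC₁ : 0 < C₁) (hC : C₁ ≤ C₂) (hT : 0 < T)
    {Ω : Set (Space N)} (hΩm : MeasurableSet Ω) (hΩ : volume Ω < ⊤)
    (hA : 0 ≤ A) (hApos : volume Ω ≠ 0 → 0 < A)
    {K : Space N → Space N → ℝ → ℝ} (hK : KernelCond s p C₁ C₂ T K)
    (hcoer : ∀ (w : Space N → ℝ) (M : ℝ), Measurable w → (∀ x, 0 ≤ w x) → (∀ x, w x ≤ M) →
      (∀ x ∉ Ω, w x = 0) → ENNReal.ofReal ((∫ x in Ω, w x ^ r) ^ θ) ≤ ENNReal.ofReal A *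
        ∫⁻ z : Space N × Space N, ENNReal.ofReal (powerDensity s p r w z.1 z.2))
    {u₀ : Space N → ℝ} (hu₀ : MemWsp0 s p Ω u₀) (hu₀b : MemLp u₀ ⊤ volume)
    (hu₀0 : ∀ᵐ x ∂(volume.restrict Ω), 0 ≤ u₀ x)
    {u : ℝ → Space N → ℝ} (hu : IsWeakSolution s p Ω K u₀ T u)
    (hub : MemLp (fun z : ℝ × Space N => u z.1 z.2) ⊤
      ((volume.restrict (timeInterval T)).prod volume))
    (hu0 : ∀ᵐ z ∂((volume.restrict (timeInterval T)).prod (volume : Measure (Space N))),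
      0 ≤ u z.1 z.2) {Tstar : ℝ}
    (hTstar : Tstar = 2 * A / (2 - p) / C₁ *
      (eLpNorm u₀ (ENNReal.ofReal r) (volume.restrict Ω)).toReal ^ (2 - p)) :
    0 ≤ Tstar ∧ (¬ u₀ =ᵐ[volume] 0 → 0 < Tstar) ∧
      ∀ t : ℝ, Tstar ≤ t → (t : EReal) ≤ T → u t =ᵐ[volume] 0 := by
  have : IsFiniteMeasure (volume.restrict Ω) := ⟨by simpa using hΩ⟩
  have hr0 : 0 < r := by linarith
  have hp2 : 0 < 2 - p := by rw [← hrθ]; exact mul_pos hr0 (by linarith)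
  set n : ℝ := (eLpNorm u₀ (ENNReal.ofReal r) (volume.restrict Ω)).toReal with hn
  have hn0 : 0 ≤ n := ENNReal.toReal_nonneg
  have hmem : MemLp u₀ (ENNReal.ofReal r) (volume.restrict Ω) :=
    (hu₀b.restrict Ω).mono_exponent le_top
  have hr_ne : ENNReal.ofReal r ≠ 0 := by simpa using hr0
  have hnr : n ^ r = ∫ x in Ω, u₀ x ^ r := by
    have hI : 0 ≤ ∫ x in Ω, ‖u₀ x‖ ^ r := integral_nonneg fun x => by positivity
    rw [hn, hmem.eLpNorm_eq_integral_rpow_norm hr_ne ENNReal.ofReal_ne_top,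
      ENNReal.toReal_ofReal hr0.le, ENNReal.toReal_ofReal (by positivity), ← Real.rpow_mul hI,
      inv_mul_cancel₀ hr0.ne', Real.rpow_one]
    refine integral_congr_ae ?_
    filter_upwards [hu₀0] with x hx
    rw [Real.norm_eq_abs, abs_of_nonneg hx]
  have hT0 : 0 ≤ Tstar := by rw [hTstar]; positivity
  have hTpos : ¬ u₀ =ᵐ[volume] 0 → 0 < Tstar := by
    intro hne
    have hnpos : 0 < n := by
      refine ENNReal.toReal_pos (fun h0 => hne ?_) hmem.2.ne
      exact ae_of_ae_restrict_of_ae_restrict_compl Ω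
        ((eLpNorm_eq_zero_iff hmem.1 hr_ne).1 h0) hu₀.eq_zero
    -- A may contain a power of |Ω| and so degenerate on a null set; a nonzero norm of u₀ on Ω
    -- excludes this.
    have hAp : 0 < A := hApos fun h0 => by
      rw [hn, Measure.restrict_eq_zero.2 h0, eLpNorm_measure_zero] at hnpos
      exact hnpos.ne' rfl
    rw [hTstar]; positivity
  refine ⟨hT0, hTpos, fun t htT ht => ?_⟩
  have key : ∀ S : ℝ, 0 < S → t ≤ S → (S : EReal) ≤ T → (T = (S : EReal) ∨ T = ⊤) →
      u t =ᵐ[volume] 0 := by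
    intro S hS htS hST hTS
    have hw := hu S hS hTS
    -- The time t = 0 can only be reached when T_* = 0, that is for zero data, and is then covered
    -- by the initial condition.
    by_cases hu₀z : u₀ =ᵐ[volume] 0 ∧ t = 0
    · rw [hu₀z.2]; exact hw.initial.trans hu₀z.1
    have hpos : 0 < t := by
      rcases (hT0.trans htT).eq_or_lt with h | h
      · refine absurd ⟨?_, h.symm⟩ hu₀z
        by_contra hne
        linarith [hTpos hne]
      · exact h
    have hac : ((volume.restrict (Ioo 0 S)).prod (volume : Measure (Space N))) ≪
        (volume.restrict (timeInterval T)).prod volume :=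
      (Measure.restrict_mono (Ioo_subset_timeInterval hST) le_rfl).absolutelyContinuous.prod
        Measure.AbsolutelyContinuous.rfl
    set M : ℝ := (eLpNormEssSup (fun z : ℝ × Space N => u z.1 z.2)
      ((volume.restrict (timeInterval T)).prod volume)).toReal with hMdef
    have hfin : eLpNormEssSup (fun z : ℝ × Space N => u z.1 z.2)
      ((volume.restrict (timeInterval T)).prod volume) ≠ ⊤ := by
      rw [← eLpNorm_exponent_top]; exact hub.2.ne
    have hbz : ∀ᵐ z ∂((volume.restrict (timeInterval T)).prod (volume : Measure (Space N))),
        u z.1 z.2 ∈ Icc 0 M := by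
      filter_upwards [hu0, ae_le_eLpNormEssSup (f := fun z : ℝ × Space N => u z.1 z.2)
        (μ := (volume.restrict (timeInterval T)).prod volume)] with z h1 h2
      refine ⟨h1, ?_⟩
      have h3 := ENNReal.toReal_mono hfin h2
      rw [toReal_enorm] at h3
      exact (le_abs_self _).trans h3
    have hb := Measure.ae_ae_of_ae_prod (hac.ae_le hbz)
    refine hw.eq_zero_of_coercivity hS hST hp hr hθ hθ1 hA hC₁ hC ENNReal.toReal_nonneg hΩm hΩ hK
      (fun w => hcoer w M) hb hpos htS ?_
    have hI : ∫ x in Ω, u 0 x ^ r = n ^ r := by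
      rw [hnr]
      refine integral_congr_ae (ae_restrict_of_ae ?_)
      filter_upwards [hw.initial] with x hx
      rw [hx]
    rw [hI, ← Real.rpow_mul hn0, hrθ]
    -- The factor 2 doubles the extinction bound, so the strict inequality required there holds even
    -- at t = T_*.
    have e : Tstar = 2 * (A / (r * C₁) * n ^ (2 - p) / (1 - θ)) := by
      have : 1 - θ ≠ 0 := by linarith
      rw [hTstar, ← hrθ]; field_simp
    rcases hT0.eq_or_lt with h0 | h0 <;> linarith
  rcases eq_or_ne T ⊤ with rfl | hTtop
  -- For T = ∞ any horizon beyond t will do; for finite T only the horizon T itself is available.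
  · exact key (t + 1) (by linarith) (by linarith) le_top (Or.inr rfl)
  · have hTbot : T ≠ ⊥ := (bot_lt_of_lt hT).ne'
    have e : ((T.toReal : ℝ) : EReal) = T := EReal.coe_toReal hTtop hTbot
    rw [← e] at ht hT
    exact key T.toReal (by exact_mod_cast hT) (by exact_mod_cast ht) e.le (Or.inl e.symm)

end FracPLap

end


/-! ### Conclusion -/

theorem theorem1p5 (N : ℕ) (hN : 1 ≤ N) (s p : ℝ) (hs : 0 < s ∧ s < 1) (hp : 1 < p ∧ p < 2) :
    ∃ γ : ℝ, 0 < γ ∧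
      ∀ (C₁ C₂ : ℝ), 0 < C₁ → C₁ ≤ C₂ →
      ∀ (T : EReal), 0 < T →
      ∀ (K : FracPLap.Space N → FracPLap.Space N → ℝ → ℝ), FracPLap.KernelCond s p C₁ C₂ T K →
      ∀ (Ω : Set (FracPLap.Space N)), IsOpen Ω → Bornology.IsBounded Ω →
      ∀ (u₀ : FracPLap.Space N → ℝ), FracPLap.MemWsp0 s p Ω u₀ → MemLp u₀ ⊤ volume →
        (∀ᵐ x ∂(volume.restrict Ω), 0 ≤ u₀ x) →
      ∀ (u : ℝ → FracPLap.Space N → ℝ), FracPLap.IsWeakSolution s p Ω K u₀ T u →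
        MemLp (fun z : ℝ × FracPLap.Space N => u z.1 z.2) ⊤
          ((volume.restrict (FracPLap.timeInterval T)).prod volume) →
        (∀ᵐ z ∂((volume.restrict (FracPLap.timeInterval T)).prod
          (volume : Measure (FracPLap.Space N))), 0 ≤ u z.1 z.2) →
      ∃ Tstar : ℝ, 0 ≤ Tstar ∧ (¬ u₀ =ᵐ[volume] 0 → 0 < Tstar) ∧
        (p < FracPLap.pCrit N s →
          Tstar = γ / C₁ * (eLpNorm u₀ (ENNReal.ofReal (N * (2 - p) / (p * s)))
            (volume.restrict Ω)).toReal ^ (2 - p)) ∧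
        (FracPLap.pCrit N s ≤ p →
          Tstar = γ / C₁ * (eLpNorm u₀ 2 (volume.restrict Ω)).toReal ^ (2 - p)
            * (volume Ω).toReal ^ (FracPLap.lam N s p 2 / (2 * N))) ∧
        ∀ t : ℝ, Tstar ≤ t → (t : EReal) ≤ T → u t =ᵐ[volume] 0 := by
  have hNpos : (0 : ℝ) < N := by exact_mod_cast hN
  have hps : 0 < p * s := mul_pos (by linarith) hs.1
  have hp2 : 0 < 2 - p := by linarith
  -- The range of p is decided before γ is chosen, so γ = 2C/(2-p) depends only on N, s and p.
  rcases lt_or_ge p (FracPLap.pCrit N s) with hpc | hpc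
  · obtain ⟨C, hC, hcoer⟩ := FracPLap.exists_coercivity_of_lt_pCrit N hN hs.1 hp.1 hpc
    have hlt : p * (N + 2 * s) < 2 * N := by
      rwa [FracPLap.pCrit, lt_div_iff₀ (by linarith)] at hpc
    refine ⟨2 * C / (2 - p), by positivity, ?_⟩
    intro C₁ C₂ hC₁ hC₂ T hT K hK Ω hΩo hΩb u₀ hu₀ hu₀b hu₀0 u hu hub hu0
    have hΩ : volume Ω < ⊤ := hΩb.measure_lt_top
    have hr : 2 ≤ N * (2 - p) / (p * s) := by
      rw [le_div_iff₀ hps]; nlinarith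
    have hpsN : p * s / N < 1 := by
      rw [div_lt_one hNpos]; nlinarith
    have hpsN0 : 0 < p * s / N := by positivity
    have hrθ : N * (2 - p) / (p * s) * (1 - (1 - p * s / N)) = 2 - p := by
      rw [sub_sub_cancel, div_mul_div_comm, mul_comm (p * s) (N : ℝ),
        mul_div_mul_right _ _ hps.ne', mul_div_cancel_left₀ _ hNpos.ne']
    obtain ⟨h1, h2, h3⟩ := FracPLap.extinction_of_coercivity hp.1 hr (θ := 1 - p * s / N)
      (by linarith) (by linarith) hrθ hC₁ hC₂ hT hΩo.measurableSet hΩ hC.le (fun _ => hC) hK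
      (hcoer Ω hΩo.measurableSet hΩ) hu₀ hu₀b hu₀0 hu hub hu0 rfl
    exact ⟨_, h1, h2, fun _ => rfl, fun h => absurd hpc (not_lt.2 h), h3⟩
  · obtain ⟨C, hC, hcoer⟩ := FracPLap.exists_coercivity_of_pCrit_le N hN hs.1 hp.1 hpc
    refine ⟨2 * C / (2 - p), by positivity, ?_⟩
    intro C₁ C₂ hC₁ hC₂ T hT K hK Ω hΩo hΩb u₀ hu₀ hu₀b hu₀0 u hu hub hu0
    have hΩ : volume Ω < ⊤ := hΩb.measure_lt_top
    -- Here A is C times |Ω|^{λ₂/(2N)}; this carries the volume factor into T_* while γ keeps only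
    -- C.
    obtain ⟨h1, h2, h3⟩ := FracPLap.extinction_of_coercivity hp.1 (le_refl (2 : ℝ)) (θ := p / 2)
      (by linarith) (by linarith) (by ring) hC₁ hC₂ hT hΩo.measurableSet hΩ
      (by positivity) (fun h0 => mul_pos hC (Real.rpow_pos_of_pos (ENNReal.toReal_pos h0 hΩ.ne) _))
      hK (hcoer Ω hΩo.measurableSet hΩ) hu₀ hu₀b hu₀0 hu hub hu0 rfl
    refine ⟨_, h1, h2, fun h => absurd h (not_lt.2 hpc), fun _ => ?_, h3⟩
    rw [ENNReal.ofReal_ofNat]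
    ring
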